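/- **Setting.** Let $T, n, M, p$ be positive integers with $T\ge 2$ and $(t-1)\mid M$ for all $t\in\{2,\dots,T\}$, let $\sigma\ge 0$, and let $w_1^*,\dots,w_T^*\in\mathbb{R}^p$ be the ground truths of $T$ tasks. A sample of task $h$ is a pair $(x,y)$ with $y=x^\top w_h^*+z$, where $x$ has i.i.d. standard Gaussian entries and $z\sim\mathcal N(0,\sigma^2)$ is independent of $x$. For each task $t\in\{1,\dots,T\}$ there is a dataset $\mathcal D_t$ of $n$ samples of task $t$, and, for $t\ge 2$ and each $h\in\{1,\dots,t-1\}$, a memory dataset $\mathcal M_{t,h}$ of $M/(t-1)$ samples of task $h$; all these samples are fresh and independent. Training on a set of samples from an initial point $w$ yields the point closest to $w$ in the $\ell_2$-norm among all $v$ with $x^\top v=y$ for every sample $(x,y)$ of the set. Both methods start from $w_0=0$ and obtain $w_t$ from $w_{t-1}$ for $t=1,\dots,T$: *concurrent rehearsal* trains once, from $w_{t-1}$, on $\mathcal D_t\cup\bigcup_{h<t}\mathcal M_{t,h}$; *sequential rehearsal* trains from $w_{t-1}$ on $\mathcal D_t$, then from the resulting point on $\mathcal M_{t,1}$, then on $\mathcal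 M_{t,2}$, and so on up to $\mathcal M_{t,t-1}$. With $\mathcal L_i(w)=\|w-w_i^*\|_2^2$, the forgetting and the generalization error of a method are $$F_T=\frac1{T-1}\sum_{i=1}^{T-1}\mathbb E\big[\mathcal L_i(w_T)-\mathcal L_i(w_i)\big],\qquad G_T=\frac1T\sum_{i=1}^{T}\mathbb E\big[\mathcal L_i(w_T)\big].$$ **Theorem.** There is an absolute constant $C>0$ such that, in this setting, if $w_1^*,\dots,w_T^*$ are orthonormal, $M\ge 2$ and $p\ge C\,T^4n^2M^2$, then $\mathbb E[\mathcal L_i(w_t)]<\infty$ for all $i\in\{1,\dots,T\}$ and $t\in\{0,\dots,T\}$ and both methods, and $$F_T^{\text{(concurrent)}}>F_T^{\text{(sequential)}}\qquad\text{and}\qquad G_T^{\text{(concurrent)}}>G_T^{\text{(sequential)}}.$$ -/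

import Mathlib

open MeasureTheory ProbabilityTheory
open scoped NNReal RealInnerProductSpace

noncomputable section

namespace Rehearsal

/-- The parameter and feature space `ℝ^p` with the `ℓ²`-norm. -/
abbrev Vec (p : ℕ) : Type := EuclideanSpace ℝ (Fin p)

/-- Indices of all training samples used in `T` tasks. Tasks are numbered `0, …, T - 1`.
`Sum.inl (t, c)` is the `c`-th of the `n` samples of the dataset of task `t`.
`Sum.inr ⟨t, (h, c)⟩` is the `c`-th of the `M / t` memory samples of the previous task `h < t`
that are used while training on task `t`; there are `t` previous tasks, so each of them receives
the share `M / t` of the memory. -/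
abbrev Sample (T n M : ℕ) : Type :=
  (Fin T × Fin n) ⊕ ((t : Fin T) × (Fin (t : ℕ) × Fin (M / (t : ℕ))))

/-- The task from whose distribution a sample is drawn. -/
def taskOf {T n M : ℕ} : Sample T n M → Fin T
  | Sum.inl q => q.1
  | Sum.inr q => ⟨q.2.1, q.2.1.isLt.trans q.1.isLt⟩

/-- The dataset of task `t`. -/
def currentData (T n M t : ℕ) : Set (Sample T n M) :=
  {s | ∃ q : Fin T × Fin n, s = Sum.inl q ∧ (q.1 : ℕ) = t}

/-- The memory dataset of the previous task `h` that is used while training on task `t`. -/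
def memoryData (T n M t h : ℕ) : Set (Sample T n M) :=
  {s | ∃ q : (t : Fin T) × (Fin (t : ℕ) × Fin (M / (t : ℕ))),
    s = Sum.inr q ∧ (q.1 : ℕ) = t ∧ (q.2.1 : ℕ) = h}

/-- The random data on a probability space: `X s` is the feature vector and `z s` the label noise
of sample `s`. All entries of all feature vectors are standard Gaussian, all noises are Gaussian
with mean `0` and standard deviation `σ`, and all these real random variables are independent. -/
structure IsGaussianData {Ω : Type*} [MeasurableSpace Ω] (P : Measure Ω) {T n M p : ℕ}
    (σ : ℝ≥0) (X : Sample T n M → Ω → Vec p) (z : Sample T n M → Ω → ℝ) : Prop where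
  law_feature : ∀ (s : Sample T n M) (k : Fin p),
    HasLaw (fun ω => X s ω k) (gaussianReal 0 1) P
  law_noise : ∀ s : Sample T n M, HasLaw (z s) (gaussianReal 0 (σ ^ 2)) P
  indep : iIndepFun
    (Sum.elim (fun (q : Sample T n M × Fin p) (ω : Ω) => X q.1 ω q.2) z) P

/-- The labels of the linear ground truth model. -/
def label {T n M p : ℕ} (wstar : Fin T → Vec p)
    (x : Sample T n M → Vec p) (z : Sample T n M → ℝ) (s : Sample T n M) : ℝ :=
  ⟪x s, wstar (taskOf s)⟫ + z s

/-- The parameters that interpolate all the samples in `A`. -/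
def interpolators {S : Type*} {p : ℕ} (x : S → Vec p) (y : S → ℝ) (A : Set S) : Set (Vec p) :=
  {w | ∀ s ∈ A, ⟪x s, w⟫ = y s}

/-- `w` is a point of `K` at minimal distance from `w₀`. -/
def IsNearest {p : ℕ} (K : Set (Vec p)) (w₀ w : Vec p) : Prop :=
  w ∈ K ∧ IsMinOn (fun v => ‖v - w₀‖ ^ 2) K w

/-- A consistent linear system has exactly one solution at minimal distance from `w₀`. -/
theorem existsUnique_isNearest {S : Type*} {p : ℕ} (x : S → Vec p) (y : S → ℝ) (A : Set S)
    (hK : (interpolators x y A).Nonempty) (w₀ : Vec p) :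
    ∃! w, IsNearest (interpolators x y A) w₀ w := by
  have hconv : Convex ℝ (interpolators x y A) := by
    intro u hu v hv a b _ _ hab s hs
    rw [inner_add_right, inner_smul_right, inner_smul_right, hu s hs, hv s hs, ← add_mul, hab,
      one_mul]
  have hclosed : IsClosed (interpolators x y A) := by
    have : interpolators x y A = ⋂ s ∈ A, {w | ⟪x s, w⟫ = y s} := by
      ext w; simp [interpolators]
    rw [this]
    exact isClosed_biInter fun s _ => isClosed_eq (by fun_prop) continuous_const
  obtain ⟨w, hw, hmin⟩ := hclosed.exists_infDist_eq_dist hK w₀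
  have hle : ∀ v ∈ interpolators x y A, ‖w - w₀‖ ^ 2 ≤ ‖v - w₀‖ ^ 2 := by
    intro v hv
    have h := Metric.infDist_le_dist_of_mem (x := w₀) hv
    rw [hmin, dist_comm, dist_eq_norm, dist_comm, dist_eq_norm] at h
    gcongr
  refine ⟨w, ⟨hw, fun v hv => hle v hv⟩, ?_⟩
  rintro v ⟨hv, hvmin⟩
  have h1 : ‖v - w₀‖ ^ 2 ≤ ‖w - w₀‖ ^ 2 := hvmin hw
  have hmid := hle _ (hconv hv hw (a := 1 / 2) (b := 1 / 2) (by norm_num) (by norm_num)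
    (by norm_num))
  have e : (1 / 2 : ℝ) • v + (1 / 2 : ℝ) • w - w₀ = (1 / 2 : ℝ) • ((v - w₀) + (w - w₀)) := by
    module
  rw [e, norm_smul, mul_pow] at hmid
  have hp := parallelogram_law_with_norm ℝ (v - w₀) (w - w₀)
  rw [sub_sub_sub_cancel_right] at hp
  norm_num at hmid
  have h0 : ‖v - w‖ = 0 := by nlinarith [norm_nonneg (v - w)]
  exact sub_eq_zero.mp (norm_eq_zero.mp h0)

open Classical in
/-- The convergence point of training with data `(x s, y s)`, `s ∈ A`, from the initial point `w₀`:
`argmin ‖w - w₀‖ ^ 2` subject to `⟪x s, w⟫ = y s` for all `s ∈ A`. If this system is inconsistent,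
the value is irrelevant (and set to `w₀`). -/
def train {S : Type*} {p : ℕ} (x : S → Vec p) (y : S → ℝ) (A : Set S) (w₀ : Vec p) : Vec p :=
  if h : ∃ w, IsNearest (interpolators x y A) w₀ w then h.choose else w₀

/-- Concurrent rehearsal: the parameters after the first `t` tasks, starting from `0`.
Each task is trained on its own dataset and all its memory datasets jointly. -/
def concurrent {T n M p : ℕ} (x : Sample T n M → Vec p) (y : Sample T n M → ℝ) : ℕ → Vec p
  | 0 => 0
  | t + 1 => train x y (currentData T n M t ∪ ⋃ h < t, memoryData T n M t h) (concurrent x y t)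

/-- Sequential rehearsal within task `t`, started at `w`: the parameters after training on the
dataset of task `t` and then, one after the other, on the memory datasets of tasks
`0, …, h - 1`. -/
def revisit {T n M p : ℕ} (x : Sample T n M → Vec p) (y : Sample T n M → ℝ) (t : ℕ) (w : Vec p) :
    ℕ → Vec p
  | 0 => train x y (currentData T n M t) w
  | h + 1 => train x y (memoryData T n M t h) (revisit x y t w h)

/-- Sequential rehearsal: the parameters after the first `t` tasks, starting from `0`. -/
def sequential {T n M p : ℕ} (x : Sample T n M → Vec p) (y : Sample T n M → ℝ) : ℕ → Vec p
  | 0 => 0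
  | t + 1 => revisit x y t (sequential x y t) t

/-- The model error of `w` over the ground truth of task `i`. -/
def modelError {T p : ℕ} (wstar : Fin T → Vec p) (i : Fin T) (w : Vec p) : ℝ :=
  ‖w - wstar i‖ ^ 2

/-- Forgetting after `T` tasks, where `w t` are the random parameters after the first `t` tasks.
The task with index `i` is the `(i + 1)`-st task, so `w (i + 1)` are the parameters right after
training on it. -/
def forgetting {Ω : Type*} [MeasurableSpace Ω] (P : Measure Ω) {T p : ℕ}
    (wstar : Fin T → Vec p) (w : ℕ → Ω → Vec p) : ℝ :=
  1 / ((T : ℝ) - 1) * ∑ i ∈ Finset.univ.filter (fun i : Fin T => (i : ℕ) + 1 < T),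
    ∫ ω, (modelError wstar i (w T ω) - modelError wstar i (w ((i : ℕ) + 1) ω)) ∂P

/-- Generalization error after `T` tasks. -/
def generalizationError {Ω : Type*} [MeasurableSpace Ω] (P : Measure Ω) {T p : ℕ}
    (wstar : Fin T → Vec p) (w : ℕ → Ω → Vec p) : ℝ :=
  1 / (T : ℝ) * ∑ i : Fin T, ∫ ω, modelError wstar i (w T ω) ∂P

/-- The random parameters of concurrent rehearsal after the first `t` tasks. -/
def concurrentParam {Ω : Type*} {T n M p : ℕ} (wstar : Fin T → Vec p)
    (X : Sample T n M → Ω → Vec p) (z : Sample T n M → Ω → ℝ) (t : ℕ) (ω : Ω) : Vec p :=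
  concurrent (fun s => X s ω) (label wstar (fun s => X s ω) (fun s => z s ω)) t

/-- The random parameters of sequential rehearsal after the first `t` tasks. -/
def sequentialParam {Ω : Type*} {T n M p : ℕ} (wstar : Fin T → Vec p)
    (X : Sample T n M → Ω → Vec p) (z : Sample T n M → Ω → ℝ) (t : ℕ) (ω : Ω) : Vec p :=
  sequential (fun s => X s ω) (label wstar (fun s => X s ω) (fun s => z s ω)) t

end Rehearsal

end

/-! All expected errors are computed exactly; what remains is an inequality between two scalar
recursions.

Training on a finite set of samples is carried out one sample at a time, Gram-Schmidt style. The
state is a pair `(W, R)`: the current fit and the projection onto the orthogonal complement of the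
features already used. A new sample moves `W` along `R x` (`fitSample`) and removes that direction
from `R` (`deflate`). The new `x` is independent of `(W, R)`, so each step only needs the Gaussian
averages of `⟪x, α⟫ * ⟪x, β⟫ / ‖Q x‖ ^ 2` for a projection `Q` of rank `k`, where directions inside
the range of `Q` weigh `1 / k` and those outside `1 / (k - 2)`
(`IsOrthProj.integral_inner_mul_inner_div`). Induction over the samples yields the exact error after
one training (`IsGaussianData.exists_fit`): the old error is multiplied by `1 - m / p` for `m`
samples, and there are added a term for the distances of the ground truths, a term for pairs of
samples with different ground truths (`truthSpread`), and a noise term.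

For orthonormal truths, let a stage have blocks of sizes `r k`, total `N`, and `J = N ^ 2 - ∑ r k ^
2`. Joint training pays for the pairs, about `J / p ^ 2`, and more for noise, about `σ ^ 2 * J / p ^
2`. Successive training pays for neither, and the only term that may favour joint training, the
drift of the error between blocks, has size at most `3 / 4 * (1 + σ ^ 2) * J / p ^ 2`. Hence each
stage widens the gap between the methods by at least a quarter of `J * (1 + σ ^ 2) / p ^ 2` and at
most five times that quantity (`jointError_sub_chainError_bounds`, `errorGap_bounds`).

Between stages the old gap shrinks by the factor `1 - N / p`. As `p` is large compared with `T * (n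
+ M)`, this loss is smaller than the gain, and the gap strictly increases from the second task on
(`errorGap_lt_succ`). The forgetting difference averages the gap at `T` minus the gap at `i + 1`,
and the generalization difference averages the gap at `T`; both are positive. -/

namespace Rehearsal

/-! ### Gaussian expectations of ratios of squares. -/

lemma integral_exp_mul_gaussianReal {s : ℝ} (hs : 0 ≤ s) (f : ℝ → ℝ) :
    ∫ x, f x * Real.exp (-(s * x ^ 2)) ∂gaussianReal 0 1 =
      (√(1 + 2 * s))⁻¹ * ∫ x, f x ∂gaussianReal 0 (Real.toNNReal (1 + 2 * s)⁻¹) := by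
  have hc : 0 < 1 + 2 * s := by positivity
  have hv : Real.toNNReal (1 + 2 * s)⁻¹ ≠ 0 := by
    simpa using hc
  rw [integral_gaussianReal_eq_integral_smul one_ne_zero,
    integral_gaussianReal_eq_integral_smul hv, ← integral_const_mul]
  refine integral_congr_ae (Filter.Eventually.of_forall fun x => ?_)
  have h1 : √(2 * Real.pi * (1 + 2 * s)⁻¹) = √(2 * Real.pi) * (√(1 + 2 * s))⁻¹ := by
    rw [Real.sqrt_mul (by positivity), Real.sqrt_inv]
  have h2 : Real.exp (-x ^ 2 / (2 * (1 + 2 * s)⁻¹)) =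
      Real.exp (-x ^ 2 / 2) * Real.exp (-(s * x ^ 2)) := by
    rw [← Real.exp_add]; congr 1; field_simp; ring
  have h3 : 0 < √(1 + 2 * s) := Real.sqrt_pos.2 hc
  simp only [gaussianPDFReal, smul_eq_mul, NNReal.coe_one, mul_one, sub_zero,
    Real.coe_toNNReal _ (inv_pos.2 hc).le]
  rw [h1, h2]
  field_simp

lemma integral_sq_gaussianReal (v : ℝ≥0) : ∫ x, x ^ 2 ∂gaussianReal 0 v = v := by
  have h := variance_fun_id_gaussianReal (μ := 0) (v := v)
  rw [variance_eq_integral (by fun_prop)] at h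
  simpa using h

lemma integrable_sq_gaussianReal (v : ℝ≥0) : Integrable (fun x : ℝ => x ^ 2) (gaussianReal 0 v) :=
  (memLp_id_gaussianReal (μ := 0) (v := v) 2).integrable_sq

/-- The four cases are written as powers of one base, so that the product over coordinates only adds
exponents. -/
lemma integral_gaussian_factor {s : ℝ} (hs : 0 ≤ s) (P Q : Prop) [Decidable P] [Decidable Q] :
    ∫ x : ℝ, (if P then x ^ 2 else 1) * (if Q then Real.exp (-(s * x ^ 2)) else 1)
      ∂gaussianReal 0 1 = (√(1 + 2 * s))⁻¹ ^
        ((if Q then 1 else 0) + 2 * (if P ∧ Q then 1 else 0)) := by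
  have hc : 0 < 1 + 2 * s := by positivity
  by_cases hP : P <;> by_cases hQ : Q
  · simp only [hP, hQ, if_true, and_self]
    rw [integral_exp_mul_gaussianReal hs, integral_sq_gaussianReal,
      Real.coe_toNNReal _ (inv_pos.2 hc).le, pow_add, pow_mul, pow_one, inv_pow (√_) 2,
      Real.sq_sqrt hc.le]
    simp
  · simp [hP, hQ, integral_sq_gaussianReal]
  · simp only [hP, hQ, if_true, if_false, false_and]
    rw [integral_exp_mul_gaussianReal hs]
    simp
  · simp [hP, hQ]

lemma integrable_gaussian_factor {s : ℝ} (hs : 0 ≤ s) (P Q : Prop) [Decidable P] [Decidable Q] :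
    Integrable (fun x : ℝ => (if P then x ^ 2 else 1) *
      (if Q then Real.exp (-(s * x ^ 2)) else 1)) (gaussianReal 0 1) := by
  have h1 : Integrable (fun x : ℝ => if P then x ^ 2 else 1) (gaussianReal 0 1) := by
    split_ifs
    · exact integrable_sq_gaussianReal 1
    · exact integrable_const _
  refine h1.mul_bdd (c := 1) (by split_ifs <;> fun_prop) (Filter.Eventually.of_forall fun x => ?_)
  split_ifs
  · rw [Real.norm_of_nonneg (Real.exp_nonneg _), Real.exp_le_one_iff]
    nlinarith [mul_nonneg hs (sq_nonneg x)]
  · simp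

lemma lintegral_inv_sqrt_pow {m : ℕ} (hm : 3 ≤ m) :
    ∫⁻ s in Set.Ioi (0 : ℝ), ENNReal.ofReal ((√(1 + 2 * s))⁻¹ ^ m) =
      ENNReal.ofReal (1 / ((m : ℝ) - 2)) := by
  have hm' : (3 : ℝ) ≤ m := by exact_mod_cast hm
  have hm2 : (m : ℝ) - 2 ≠ 0 := by linarith
  have hfun : ∀ s ∈ Set.Ici (0 : ℝ), (√(1 + 2 * s))⁻¹ ^ m = (1 + 2 * s) ^ (-(m : ℝ) / 2) := by
    intro s hs
    have hc : (0 : ℝ) < 1 + 2 * s := by have : (0 : ℝ) ≤ s := hs; linarith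
    rw [Real.sqrt_eq_rpow, ← Real.rpow_neg hc.le, ← Real.rpow_natCast, ← Real.rpow_mul hc.le]
    congr 1; ring
  set F : ℝ → ℝ := fun s => -(1 / ((m : ℝ) - 2)) * (1 + 2 * s) ^ (1 - (m : ℝ) / 2) with hF
  have hd : ∀ s ∈ Set.Ici (0 : ℝ), HasDerivAt F ((√(1 + 2 * s))⁻¹ ^ m) s := by
    intro s hs
    have hc : (0 : ℝ) < 1 + 2 * s := by have : (0 : ℝ) ≤ s := hs; linarith
    rw [hfun s hs]
    have h1 : HasDerivAt (fun s : ℝ => 1 + 2 * s) 2 s := by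
      simpa using ((hasDerivAt_id s).const_mul 2).const_add 1
    have h2 := (h1.rpow_const (p := 1 - (m : ℝ) / 2) (Or.inl hc.ne')).const_mul
      (-(1 / ((m : ℝ) - 2)))
    convert! h2 using 1
    rw [show 1 - (m : ℝ) / 2 - 1 = -(m : ℝ) / 2 by ring]
    field_simp
    ring
  have hpos : ∀ s ∈ Set.Ioi (0 : ℝ), 0 ≤ (√(1 + 2 * s))⁻¹ ^ m := fun s _ => by positivity
  have hlim : Filter.Tendsto F Filter.atTop (nhds 0) := by
    have h1 : Filter.Tendsto (fun s : ℝ => 1 + 2 * s) Filter.atTop Filter.atTop :=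
      Filter.tendsto_atTop_add_const_left _ _ (Filter.tendsto_id.const_mul_atTop (by norm_num))
    have h2 := (tendsto_rpow_neg_atTop (y := (m : ℝ) / 2 - 1) (by linarith)).comp h1
    have h3 := h2.const_mul (-(1 / ((m : ℝ) - 2)))
    rw [mul_zero] at h3
    refine h3.congr fun s => ?_
    simp only [hF, Function.comp]
    congr 2; ring
  have hint := integrableOn_Ioi_deriv_of_nonneg' hd hpos hlim
  have hval := integral_Ioi_of_hasDerivAt_of_nonneg' hd hpos hlim
  rw [← ofReal_integral_eq_lintegral_ofReal hint
    ((ae_restrict_iff' measurableSet_Ioi).2 (Filter.Eventually.of_forall hpos)), hval]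
  simp [hF]

/-- Replaces a reciprocal of a sum of squares by exponentials that factor over the coordinates. For
`N = 0` both sides are infinite, so no null set has to be excluded, and finiteness of the expected
reciprocal later gives positivity almost everywhere. -/
lemma lintegral_exp_neg_mul_Ioi {N : ℝ} (hN : 0 ≤ N) :
    ∫⁻ s in Set.Ioi (0 : ℝ), ENNReal.ofReal (Real.exp (-(s * N))) = (ENNReal.ofReal N)⁻¹ := by
  rcases hN.eq_or_lt with rfl | hN
  · simp
  · have h1 : ∀ s, Real.exp (-(s * N)) = Real.exp (-N * s) := fun s => by congr 1; ring
    simp_rw [h1]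
    rw [← ofReal_integral_eq_lintegral_ofReal
      (integrableOn_exp_mul_Ioi (by linarith) 0)
      (Filter.Eventually.of_forall fun s => Real.exp_nonneg _),
      integral_exp_mul_Ioi (by linarith), ← ENNReal.ofReal_inv_of_pos hN]
    congr 1
    simp

variable {ι : Type*} [Fintype ι] [DecidableEq ι]

lemma lintegral_pi_sq_exp {s : ℝ} (hs : 0 ≤ s) (I J : Finset ι) :
    ∫⁻ x : ι → ℝ, ENNReal.ofReal ((∏ i ∈ I, x i ^ 2) * Real.exp (-(s * ∑ j ∈ J, x j ^ 2)))
      ∂Measure.pi (fun _ => gaussianReal 0 1) =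
      ENNReal.ofReal ((√(1 + 2 * s))⁻¹ ^ (J.card + 2 * (I ∩ J).card)) := by
  have h : ∀ x : ι → ℝ, (∏ i ∈ I, x i ^ 2) * Real.exp (-(s * ∑ j ∈ J, x j ^ 2)) =
      ∏ i, (if i ∈ I then x i ^ 2 else 1) * (if i ∈ J then Real.exp (-(s * x i ^ 2)) else 1) := by
    intro x
    rw [Finset.prod_mul_distrib, Finset.prod_ite_mem, Finset.prod_ite_mem, Finset.univ_inter,
      Finset.univ_inter, ← Real.exp_sum, Finset.sum_neg_distrib, Finset.mul_sum]
  simp_rw [h]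
  rw [← ofReal_integral_eq_lintegral_ofReal
    (Integrable.fintype_prod (f := fun i (x : ℝ) => (if i ∈ I then x ^ 2 else 1) *
      (if i ∈ J then Real.exp (-(s * x ^ 2)) else 1))
      fun i => integrable_gaussian_factor hs _ _)
    (Filter.Eventually.of_forall fun x => by
      simp only [Pi.zero_apply]
      rw [← h]
      exact mul_nonneg (Finset.prod_nonneg fun _ _ => sq_nonneg _) (Real.exp_nonneg _)),
    integral_fintype_prod_eq_prod (f := fun i (x : ℝ) => (if i ∈ I then x ^ 2 else 1) *
      (if i ∈ J then Real.exp (-(s * x ^ 2)) else 1))]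
  simp_rw [integral_gaussian_factor hs]
  rw [Finset.prod_pow_eq_pow_sum, Finset.sum_add_distrib, ← Finset.mul_sum]
  simp_rw [← Finset.mem_inter, Finset.sum_ite_mem]
  simp

/-- Write the reciprocal as a Laplace integral and swap by Tonelli. For fixed `s` the Gaussian
integral is a power of `1 + 2 * s`, whose integral over `s` is elementary. Three coordinates in `J`
ensure convergence. -/
lemma lintegral_pi_sq_inv (I J : Finset ι) (hJ : 3 ≤ J.card) :
    ∫⁻ x : ι → ℝ, ENNReal.ofReal (∏ i ∈ I, x i ^ 2) * (ENNReal.ofReal (∑ j ∈ J, x j ^ 2))⁻¹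
      ∂Measure.pi (fun _ => gaussianReal 0 1) =
      ENNReal.ofReal (1 / (((J.card + 2 * (I ∩ J).card : ℕ) : ℝ) - 2)) := by
  have h : ∀ x : ι → ℝ,
      ENNReal.ofReal (∏ i ∈ I, x i ^ 2) * (ENNReal.ofReal (∑ j ∈ J, x j ^ 2))⁻¹ =
      ∫⁻ s in Set.Ioi (0 : ℝ),
        ENNReal.ofReal ((∏ i ∈ I, x i ^ 2) * Real.exp (-(s * ∑ j ∈ J, x j ^ 2))) := by
    intro x
    rw [← lintegral_exp_neg_mul_Ioi (Finset.sum_nonneg fun _ _ => sq_nonneg _),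
      ← lintegral_const_mul _ (by fun_prop)]
    refine lintegral_congr fun s => ?_
    rw [ENNReal.ofReal_mul (Finset.prod_nonneg fun _ _ => sq_nonneg _)]
  simp_rw [h]
  rw [lintegral_lintegral_swap (by fun_prop), ← lintegral_inv_sqrt_pow (by omega)]
  refine setLIntegral_congr_fun measurableSet_Ioi fun s hs => ?_
  exact lintegral_pi_sq_exp (le_of_lt hs) I J

lemma ae_sum_sq_pos (J : Finset ι) (hJ : 3 ≤ J.card) :
    ∀ᵐ x : ι → ℝ ∂Measure.pi (fun _ => gaussianReal 0 1), 0 < ∑ j ∈ J, x j ^ 2 := by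
  have h := lintegral_pi_sq_inv ∅ J hJ
  simp only [Finset.prod_empty, ENNReal.ofReal_one, one_mul] at h
  have := ae_lt_top (by fun_prop) (h.trans_ne ENNReal.ofReal_ne_top)
  filter_upwards [this] with x hx
  simpa [ENNReal.inv_lt_top] using hx

lemma integral_pi_prod_sq_div (I J : Finset ι) (hJ : 3 ≤ J.card) :
    Integrable (fun x : ι → ℝ => (∏ i ∈ I, x i ^ 2) / ∑ j ∈ J, x j ^ 2)
      (Measure.pi (fun _ => gaussianReal 0 1)) ∧
    ∫ x : ι → ℝ, (∏ i ∈ I, x i ^ 2) / ∑ j ∈ J, x j ^ 2 ∂Measure.pi (fun _ => gaussianReal 0 1) =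
      1 / (((J.card + 2 * (I ∩ J).card : ℕ) : ℝ) - 2) := by
  have h0 : ∀ x : ι → ℝ, 0 ≤ (∏ i ∈ I, x i ^ 2) / ∑ j ∈ J, x j ^ 2 := fun x =>
    div_nonneg (Finset.prod_nonneg fun _ _ => sq_nonneg _) (Finset.sum_nonneg fun _ _ => sq_nonneg _)
  have h : ∫⁻ x : ι → ℝ, ENNReal.ofReal ((∏ i ∈ I, x i ^ 2) / ∑ j ∈ J, x j ^ 2)
      ∂Measure.pi (fun _ => gaussianReal 0 1) =
      ENNReal.ofReal (1 / (((J.card + 2 * (I ∩ J).card : ℕ) : ℝ) - 2)) := by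
    rw [← lintegral_pi_sq_inv I J hJ]
    refine lintegral_congr_ae ?_
    filter_upwards [ae_sum_sq_pos J hJ] with x hx
    rw [ENNReal.ofReal_div_of_pos hx, div_eq_mul_inv]
  have hm : AEStronglyMeasurable (fun x : ι → ℝ => (∏ i ∈ I, x i ^ 2) / ∑ j ∈ J, x j ^ 2)
      (Measure.pi (fun _ => gaussianReal 0 1)) := by
    have : Measurable (fun x : ι → ℝ => (∏ i ∈ I, x i ^ 2) / ∑ j ∈ J, x j ^ 2) := by fun_prop
    exact this.aestronglyMeasurable
  refine ⟨⟨hm, ?_⟩, ?_⟩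
  · rw [hasFiniteIntegral_iff_ofReal (Filter.Eventually.of_forall h0), h]
    exact ENNReal.ofReal_lt_top
  · rw [integral_eq_lintegral_of_nonneg_ae (Filter.Eventually.of_forall h0) hm, h,
      ENNReal.toReal_ofReal]
    have : (3 : ℝ) ≤ ((J.card + 2 * (I ∩ J).card : ℕ) : ℝ) := by
      exact_mod_cast (by omega : 3 ≤ J.card + 2 * (I ∩ J).card)
    exact one_div_nonneg.2 (by linarith)

lemma integral_pi_mul_div (J : Finset ι) (hJ : 3 ≤ J.card) (i j : ι) :
    Integrable (fun x : ι → ℝ => x i * x j / ∑ l ∈ J, x l ^ 2)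
      (Measure.pi (fun _ => gaussianReal 0 1)) ∧
    ∫ x : ι → ℝ, x i * x j / ∑ l ∈ J, x l ^ 2 ∂Measure.pi (fun _ => gaussianReal 0 1) =
      if i = j then (if i ∈ J then 1 / (J.card : ℝ) else 1 / ((J.card : ℝ) - 2)) else 0 := by
  have hsq : ∀ i : ι, Integrable (fun x : ι → ℝ => x i ^ 2 / ∑ l ∈ J, x l ^ 2)
      (Measure.pi (fun _ => gaussianReal 0 1)) := fun i => by
    simpa using (integral_pi_prod_sq_div {i} J hJ).1
  have hint : Integrable (fun x : ι → ℝ => x i * x j / ∑ l ∈ J, x l ^ 2)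
      (Measure.pi (fun _ => gaussianReal 0 1)) := by
    refine ((hsq i).add (hsq j)).mono' ?_ (Filter.Eventually.of_forall fun x => ?_)
    · have : Measurable (fun x : ι → ℝ => x i * x j / ∑ l ∈ J, x l ^ 2) := by fun_prop
      exact this.aestronglyMeasurable
    · have hN : 0 ≤ ∑ l ∈ J, x l ^ 2 := Finset.sum_nonneg fun _ _ => sq_nonneg _
      rw [Pi.add_apply, ← add_div, Real.norm_eq_abs, abs_div, abs_of_nonneg hN]
      gcongr
      rw [abs_mul]
      nlinarith [sq_abs (x i), sq_abs (x j), sq_nonneg (|x i| - |x j|), sq_nonneg (x i),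
        sq_nonneg (x j)]
  refine ⟨hint, ?_⟩
  split_ifs with hij hi
  · subst hij
    have h := (integral_pi_prod_sq_div {i} J hJ).2
    simp only [Finset.prod_singleton, Finset.singleton_inter_of_mem hi, Finset.card_singleton] at h
    simp_rw [← sq]
    rw [h]; push_cast; congr 1; ring
  · subst hij
    have h := (integral_pi_prod_sq_div {i} J hJ).2
    simp only [Finset.prod_singleton, Finset.singleton_inter_of_notMem hi, Finset.card_empty] at h
    simp_rw [← sq]
    rw [h]; push_cast; congr 1; ring
  -- Off the diagonal, flipping the sign of coordinate `i` preserves the law and negates the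
  -- integrand.
  · have hmp : MeasurePreserving (fun (x : ι → ℝ) l => if l = i then -x l else x l)
        (Measure.pi (fun _ => gaussianReal 0 1)) (Measure.pi (fun _ => gaussianReal 0 1)) := by
      refine measurePreserving_pi (f := fun l (y : ℝ) => if l = i then -y else y) _ _ fun l => ?_
      by_cases hl : l = i
      · simp only [hl, if_true]
        exact ⟨measurable_neg, by simpa using gaussianReal_map_neg (μ := 0) (v := 1)⟩
      · simp only [hl, if_false]
        exact MeasurePreserving.id _
    have h := integral_map hmp.measurable.aemeasurable (μ := Measure.pi (fun _ => gaussianReal 0 1))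
      (f := fun x : ι → ℝ => x i * x j / ∑ l ∈ J, x l ^ 2)
      (by rw [hmp.map_eq]; exact hint.aestronglyMeasurable)
    rw [hmp.map_eq] at h
    simp only [if_true, if_neg (Ne.symm hij)] at h
    have h2 : ∀ x : ι → ℝ, ∑ l ∈ J, (if l = i then -x l else x l) ^ 2 = ∑ l ∈ J, x l ^ 2 :=
      fun x => Finset.sum_congr rfl fun l _ => by split_ifs <;> simp
    simp_rw [h2, neg_mul, neg_div, integral_neg] at h
    linarith

lemma integral_pi_inv (J : Finset ι) (hJ : 3 ≤ J.card) :
    Integrable (fun x : ι → ℝ => (∑ l ∈ J, x l ^ 2)⁻¹) (Measure.pi (fun _ => gaussianReal 0 1)) ∧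
    ∫ x : ι → ℝ, (∑ l ∈ J, x l ^ 2)⁻¹ ∂Measure.pi (fun _ => gaussianReal 0 1) =
      1 / ((J.card : ℝ) - 2) := by
  simpa using integral_pi_prod_sq_div ∅ J hJ

end Rehearsal

/-! ### Orthogonal projections and the fit of a single Gaussian sample. -/

namespace Rehearsal

variable {p : ℕ}

/-- `Q` is an orthogonal projection of rank `k`. -/
structure IsOrthProj (Q : Vec p →L[ℝ] Vec p) (k : ℕ) : Prop where
  symm : ∀ a b, ⟪Q a, b⟫ = ⟪a, Q b⟫
  idem : ∀ a, Q (Q a) = Q a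
  trace : LinearMap.trace ℝ (Vec p) (Q : Vec p →ₗ[ℝ] Vec p) = k

lemma isOrthProj_id : IsOrthProj (ContinuousLinearMap.id ℝ (Vec p)) p where
  symm _ _ := rfl
  idem _ := rfl
  trace := by simp

/-- A symmetric idempotent has eigenvalues `0` and `1`, and the trace counts the ones. -/
lemma IsOrthProj.exists_basis {Q : Vec p →L[ℝ] Vec p} {k : ℕ} (hQ : IsOrthProj Q k) :
    ∃ (b : OrthonormalBasis (Fin p) ℝ (Vec p)) (J : Finset (Fin p)), J.card = k ∧
      ∀ i, Q (b i) = if i ∈ J then b i else 0 := by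
  have hs : (Q : Vec p →ₗ[ℝ] Vec p).IsSymmetric := hQ.symm
  have hn : Module.finrank ℝ (Vec p) = p := by simp
  have happ : ∀ i, Q (hs.eigenvectorBasis hn i) =
      (hs.eigenvalues hn i : ℝ) • hs.eigenvectorBasis hn i := fun i =>
    hs.apply_eigenvectorBasis hn i
  have h01 : ∀ i, hs.eigenvalues hn i = 0 ∨ hs.eigenvalues hn i = 1 := by
    intro i
    have h1 := hQ.idem (hs.eigenvectorBasis hn i)
    rw [happ, map_smul, happ, smul_smul] at h1
    have h2 := congrArg (fun v => ⟪hs.eigenvectorBasis hn i, v⟫) h1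
    simp only [inner_smul_right, OrthonormalBasis.inner_eq_one, mul_one] at h2
    have h3 : hs.eigenvalues hn i * (hs.eigenvalues hn i - 1) = 0 := by linarith
    rcases mul_eq_zero.1 h3 with h | h
    · exact Or.inl h
    · exact Or.inr (by linarith)
  refine ⟨hs.eigenvectorBasis hn, Finset.univ.filter fun i => hs.eigenvalues hn i = 1, ?_, ?_⟩
  · have h := hs.trace_eq_sum_eigenvalues hn
    rw [hQ.trace] at h
    have h2 : ∀ i, hs.eigenvalues hn i = if hs.eigenvalues hn i = 1 then 1 else 0 := fun i => by
      rcases h01 i with h | h <;> simp [h]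
    rw [Finset.sum_congr rfl fun i _ => h2 i] at h
    simp only [RCLike.ofReal_real_eq_id, id, Finset.sum_boole] at h
    exact_mod_cast h.symm
  · intro i
    rw [happ]
    rcases h01 i with h | h <;> simp [h]

/-- The standard Gaussian has independent standard coordinates in every orthonormal basis. In an
eigenbasis of `Q` the denominator is a sum of `k` squares, so only diagonal terms survive, with
weights `1 / k` or `1 / (k - 2)`. -/
lemma IsOrthProj.integral_inner_mul_inner_div {Q : Vec p →L[ℝ] Vec p} {k : ℕ}
    (hQ : IsOrthProj Q k) (hk : 3 ≤ k) (α β : Vec p) :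
    Integrable (fun x => ⟪x, α⟫ * ⟪x, β⟫ / ‖Q x‖ ^ 2) (stdGaussian (Vec p)) ∧
    ∫ x, ⟪x, α⟫ * ⟪x, β⟫ / ‖Q x‖ ^ 2 ∂stdGaussian (Vec p) =
      ⟪Q α, Q β⟫ / k + (⟪α, β⟫ - ⟪Q α, Q β⟫) / ((k : ℝ) - 2) := by
  obtain ⟨b, J, rfl, hb⟩ := hQ.exists_basis
  have hm : Measurable (fun x => ⟪x, α⟫ * ⟪x, β⟫ / ‖Q x‖ ^ 2) := by fun_prop
  have hφ : Measurable (fun x : Fin p → ℝ => ∑ i, x i • b i) := by fun_prop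
  have hin : ∀ (x : Fin p → ℝ) (α : Vec p), ⟪∑ i, x i • b i, α⟫ = ∑ i, x i * ⟪b i, α⟫ := by
    intro x α
    simp [sum_inner, inner_smul_left]
  have hqn : ∀ x : Fin p → ℝ, ‖Q (∑ i, x i • b i)‖ ^ 2 = ∑ l ∈ J, x l ^ 2 := by
    intro x
    rw [← b.sum_sq_inner_right]
    have : ∀ i, ⟪b i, Q (∑ i, x i • b i)⟫ = if i ∈ J then x i else 0 := by
      intro i
      rw [← hQ.symm, hb]
      split_ifs with h
      · rw [real_inner_comm, hin]
        simp [b.inner_eq_ite]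
      · simp
    simp_rw [this, ite_pow]
    simp
  have hQin : ⟪Q α, Q β⟫ = ∑ i, if i ∈ J then ⟪b i, α⟫ * ⟪b i, β⟫ else 0 := by
    rw [← b.sum_inner_mul_inner]
    refine Finset.sum_congr rfl fun i _ => ?_
    rw [hQ.symm, ← hQ.symm (b i), hb]
    split_ifs with h
    · rw [real_inner_comm]
    · simp
  have hin2 : ⟪α, β⟫ = ∑ i, ⟪b i, α⟫ * ⟪b i, β⟫ := by
    rw [← b.sum_inner_mul_inner]
    refine Finset.sum_congr rfl fun i _ => by rw [real_inner_comm]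
  have hexp : ∀ x : Fin p → ℝ,
      ⟪∑ i, x i • b i, α⟫ * ⟪∑ i, x i • b i, β⟫ / ‖Q (∑ i, x i • b i)‖ ^ 2 =
      ∑ i, ∑ j, (⟪b i, α⟫ * ⟪b j, β⟫) * (x i * x j / ∑ l ∈ J, x l ^ 2) := by
    intro x
    rw [hqn, hin, hin, Finset.sum_mul_sum, Finset.sum_div]
    refine Finset.sum_congr rfl fun i _ => ?_
    rw [Finset.sum_div]
    exact Finset.sum_congr rfl fun j _ => by ring
  have hI := fun i j => integral_pi_mul_div J hk i j
  rw [stdGaussian_eq_map_pi_orthonormalBasis b, integrable_map_measure hm.aestronglyMeasurable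
    hφ.aemeasurable, integral_map hφ.aemeasurable hm.aestronglyMeasurable]
  simp_rw [Function.comp_def, hexp]
  refine ⟨integrable_finsetSum _ fun i _ => integrable_finsetSum _ fun j _ =>
    (hI i j).1.const_mul _, ?_⟩
  rw [integral_finsetSum _ fun i _ => integrable_finsetSum _ fun j _ =>
    (hI i j).1.const_mul _]
  simp_rw [integral_finsetSum _ fun j _ => (hI _ j).1.const_mul _, integral_const_mul, (hI _ _).2]
  simp only [mul_ite, mul_zero, Finset.sum_ite_eq, Finset.mem_univ, if_true]
  rw [hQin, hin2, ← Finset.sum_sub_distrib, Finset.sum_div, Finset.sum_div,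
    ← Finset.sum_add_distrib]
  refine Finset.sum_congr rfl fun i _ => ?_
  split_ifs <;> ring

lemma IsOrthProj.integral_inv_norm_sq {Q : Vec p →L[ℝ] Vec p} {k : ℕ}
    (hQ : IsOrthProj Q k) (hk : 3 ≤ k) :
    Integrable (fun x => (‖Q x‖ ^ 2)⁻¹) (stdGaussian (Vec p)) ∧
    ∫ x, (‖Q x‖ ^ 2)⁻¹ ∂stdGaussian (Vec p) = 1 / ((k : ℝ) - 2) ∧
    ∀ᵐ x ∂stdGaussian (Vec p), Q x ≠ 0 := by
  obtain ⟨b, J, rfl, hb⟩ := hQ.exists_basis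
  have hm : Measurable (fun x => (‖Q x‖ ^ 2)⁻¹) := by fun_prop
  have hφ : Measurable (fun x : Fin p → ℝ => ∑ i, x i • b i) := by fun_prop
  have hqn : ∀ x : Fin p → ℝ, ‖Q (∑ i, x i • b i)‖ ^ 2 = ∑ l ∈ J, x l ^ 2 := by
    intro x
    rw [← b.sum_sq_inner_right]
    have : ∀ i, ⟪b i, Q (∑ i, x i • b i)⟫ = if i ∈ J then x i else 0 := by
      intro i
      rw [← hQ.symm, hb]
      split_ifs with h
      · simp [inner_sum, inner_smul_right, b.inner_eq_ite]
      · simp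
    simp_rw [this, ite_pow]
    simp
  rw [stdGaussian_eq_map_pi_orthonormalBasis b, integrable_map_measure hm.aestronglyMeasurable
    hφ.aemeasurable, integral_map hφ.aemeasurable hm.aestronglyMeasurable]
  simp_rw [Function.comp_def, hqn]
  refine ⟨(integral_pi_inv J hk).1, (integral_pi_inv J hk).2, ?_⟩
  rw [ae_map_iff hφ.aemeasurable (by measurability)]
  filter_upwards [ae_sum_sq_pos J hk] with x hx h0
  rw [← hqn, h0] at hx
  simp at hx

/-- The parameters after one more sample `(x, y)` is fitted by a step in direction `Q x`. -/
noncomputable def fitSample (w : Vec p) (Q : Vec p →L[ℝ] Vec p) (x : Vec p) (y : ℝ) : Vec p :=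
  w + ((y - ⟪x, w⟫) / ‖Q x‖ ^ 2) • Q x

/-- The projection `Q` with the direction `Q x` removed from its range. -/
noncomputable def deflate (Q : Vec p →L[ℝ] Vec p) (x : Vec p) : Vec p →L[ℝ] Vec p :=
  Q - (‖Q x‖ ^ 2)⁻¹ • (innerSL ℝ (Q x)).smulRight (Q x)

lemma deflate_apply (Q : Vec p →L[ℝ] Vec p) (x v : Vec p) :
    deflate Q x v = Q v - (⟪Q x, v⟫ / ‖Q x‖ ^ 2) • Q x := by
  simp only [deflate, _root_.sub_apply, _root_.smul_apply,
    ContinuousLinearMap.smulRight_apply, innerSL_apply_apply, smul_smul]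
  rw [div_eq_inv_mul]

lemma IsOrthProj.inner_apply_apply {Q : Vec p →L[ℝ] Vec p} {k : ℕ} (hQ : IsOrthProj Q k)
    (a b : Vec p) : ⟪Q a, Q b⟫ = ⟪Q a, b⟫ := by
  rw [← hQ.symm, hQ.idem]

/-- Subtracting the rank-one projection onto a unit multiple of `Q x`, a vector in the range of `Q`,
lowers the trace by one. -/
lemma IsOrthProj.deflate {Q : Vec p →L[ℝ] Vec p} {k : ℕ} (hQ : IsOrthProj Q (k + 1))
    {x : Vec p} (hx : Q x ≠ 0) : IsOrthProj (deflate Q x) k where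
  symm a b := by
    rw [deflate_apply, deflate_apply, inner_sub_left, inner_sub_right, hQ.symm,
      inner_smul_left, inner_smul_right, real_inner_comm (Q x) a]
    simp only [conj_trivial]
    ring
  idem a := by
    have hn : ‖Q x‖ ^ 2 ≠ 0 := by simpa using hx
    rw [deflate_apply, deflate_apply, map_sub, map_smul, hQ.idem, hQ.idem, inner_sub_right,
      inner_smul_right, hQ.inner_apply_apply, real_inner_self_eq_norm_sq, div_mul_cancel₀ _ hn]
    simp
  trace := by
    have hn : ‖Q x‖ ^ 2 ≠ 0 := by simpa using hx
    let b := stdOrthonormalBasis ℝ (Vec p)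
    have h := hQ.trace
    rw [LinearMap.trace_eq_sum_inner _ b] at h ⊢
    simp only [ContinuousLinearMap.coe_coe] at h ⊢
    simp_rw [deflate_apply, inner_sub_right, inner_smul_right, Finset.sum_sub_distrib]
    have h2 : ∑ i, ⟪Q x, b i⟫ / ‖Q x‖ ^ 2 * ⟪b i, Q x⟫ = 1 := by
      have h3 := b.sum_sq_inner_right (Q x)
      have h4 : ∀ i, ⟪Q x, b i⟫ / ‖Q x‖ ^ 2 * ⟪b i, Q x⟫ = ⟪b i, Q x⟫ ^ 2 / ‖Q x‖ ^ 2 := by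
        intro i; rw [real_inner_comm]; ring
      simp_rw [h4]
      rw [← Finset.sum_div, h3, div_self hn]
    rw [h, h2]
    push_cast
    ring

/-- The step moves `w` only along `Q x`, the direction that deflation kills. Projected errors
therefore evolve without reference to labels or noise. -/
lemma IsOrthProj.deflate_fitSample {Q : Vec p →L[ℝ] Vec p} {k : ℕ} (hQ : IsOrthProj Q k)
    (w x v : Vec p) (y : ℝ) :
    Rehearsal.deflate Q x (fitSample w Q x y - v) = Rehearsal.deflate Q x (w - v) := by
  have h0 : Rehearsal.deflate Q x (Q x) = 0 := by
    rw [deflate_apply, hQ.idem, real_inner_self_eq_norm_sq]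
    by_cases hx : Q x = 0
    · simp [hx]
    · rw [div_self (by simpa using hx), one_smul, sub_self]
  rw [fitSample, add_sub_right_comm, map_add, map_smul, h0, smul_zero, add_zero]

lemma IsOrthProj.norm_deflate_sq {Q : Vec p →L[ℝ] Vec p} {k : ℕ} (hQ : IsOrthProj Q k)
    (x a : Vec p) :
    ‖Rehearsal.deflate Q x a‖ ^ 2 = ‖Q a‖ ^ 2 - ⟪x, Q a⟫ * ⟪x, Q a⟫ / ‖Q x‖ ^ 2 := by
  have h1 : ⟪Q x, a⟫ = ⟪x, Q a⟫ := hQ.symm x a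
  rw [deflate_apply, norm_sub_sq_real, inner_smul_right, norm_smul, h1, real_inner_comm (Q x),
    hQ.inner_apply_apply, hQ.symm x a, mul_pow, Real.norm_eq_abs, sq_abs]
  by_cases hx : Q x = 0
  · simp [hx]
  · have hn : ‖Q x‖ ^ 2 ≠ 0 := by simpa using hx
    field_simp
    ring

lemma IsOrthProj.integral_norm_deflate_sq {Q : Vec p →L[ℝ] Vec p} {k : ℕ} (hQ : IsOrthProj Q k)
    (hk : 3 ≤ k) (a : Vec p) :
    Integrable (fun x => ‖Rehearsal.deflate Q x a‖ ^ 2) (stdGaussian (Vec p)) ∧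
    ∫ x, ‖Rehearsal.deflate Q x a‖ ^ 2 ∂stdGaussian (Vec p) = (1 - 1 / k) * ‖Q a‖ ^ 2 := by
  simp_rw [hQ.norm_deflate_sq]
  have h := hQ.integral_inner_mul_inner_div hk (Q a) (Q a)
  refine ⟨(integrable_const _).sub h.1, ?_⟩
  rw [integral_sub (integrable_const _) h.1, h.2]
  simp [hQ.idem]
  ring

lemma norm_fitSample_sub_sq (w wh v x : Vec p) (Q : Vec p →L[ℝ] Vec p)
    (hQ : ∀ a b, ⟪Q a, b⟫ = ⟪a, Q b⟫) (z : ℝ) :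
    ‖fitSample w Q x (⟪x, wh⟫ + z) - v‖ ^ 2 = ‖w - v‖ ^ 2 +
      2 * (⟪x, wh - w⟫ * ⟪x, Q (w - v)⟫ / ‖Q x‖ ^ 2) +
      ⟪x, wh - w⟫ * ⟪x, wh - w⟫ / ‖Q x‖ ^ 2 +
      (2 * (⟪x, Q (w - v)⟫ + ⟪x, wh - w⟫) / ‖Q x‖ ^ 2) * z + (‖Q x‖ ^ 2)⁻¹ * z ^ 2 := by
  have e : fitSample w Q x (⟪x, wh⟫ + z) - v =
      (w - v) + ((⟪x, wh - w⟫ + z) / ‖Q x‖ ^ 2) • Q x := by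
    rw [fitSample, inner_sub_right]
    have : ⟪x, wh⟫ + z - ⟪x, w⟫ = ⟪x, wh⟫ - ⟪x, w⟫ + z := by ring
    rw [this]; abel
  rw [e, norm_add_sq_real, inner_smul_right, norm_smul, mul_pow, Real.norm_eq_abs, sq_abs,
    real_inner_comm (Q x), hQ]
  by_cases hx : Q x = 0
  · simp [hx]
  · have hn : ‖Q x‖ ^ 2 ≠ 0 := by simpa using hx
    field_simp
    ring

lemma IsOrthProj.integrable_inner_div {Q : Vec p →L[ℝ] Vec p} {k : ℕ}
    (hQ : IsOrthProj Q k) (hk : 3 ≤ k) (α : Vec p) :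
    Integrable (fun x => ⟪x, α⟫ / ‖Q x‖ ^ 2) (stdGaussian (Vec p)) := by
  have hm : Measurable (fun x => ⟪x, α⟫ / ‖Q x‖ ^ 2) := by fun_prop
  refine ((hQ.integral_inner_mul_inner_div hk α α).1.add (hQ.integral_inv_norm_sq hk).1).mono'
    hm.aestronglyMeasurable (Filter.Eventually.of_forall fun x => ?_)
  rw [Pi.add_apply, ← one_div (‖Q x‖ ^ 2), ← add_div, norm_div, Real.norm_of_nonneg (sq_nonneg _)]
  gcongr
  rw [Real.norm_eq_abs]
  nlinarith [sq_abs ⟪x, α⟫, sq_nonneg (|⟪x, α⟫| - 1), sq_nonneg (|⟪x, α⟫|)]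

/-- The square is expanded in powers of the noise: the linear part has mean zero, the quadratic part
gives `σ ^ 2 / (k - 2)`. In the noiseless part the terms of weight `1 / k` complete a square in `Q
(wh - v)`; the part of the residual outside the range of `Q` has weight `1 / (k - 2)`. -/
lemma IsOrthProj.integral_norm_fitSample_sub_sq {Q : Vec p →L[ℝ] Vec p} {k : ℕ}
    (hQ : IsOrthProj Q k) (hk : 3 ≤ k) (σ : ℝ≥0) (w wh v : Vec p) :
    Integrable (fun u : Vec p × ℝ => ‖fitSample w Q u.1 (⟪u.1, wh⟫ + u.2) - v‖ ^ 2)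
      ((stdGaussian (Vec p)).prod (gaussianReal 0 (σ ^ 2))) ∧
    ∫ u : Vec p × ℝ, ‖fitSample w Q u.1 (⟪u.1, wh⟫ + u.2) - v‖ ^ 2
      ∂(stdGaussian (Vec p)).prod (gaussianReal 0 (σ ^ 2)) =
      ‖w - v‖ ^ 2 - ‖Q (w - v)‖ ^ 2 / k + ‖Q (wh - v)‖ ^ 2 / k +
        (‖w - wh‖ ^ 2 - ‖Q (w - wh)‖ ^ 2) / ((k : ℝ) - 2) + (σ : ℝ) ^ 2 / ((k : ℝ) - 2) := by
  simp_rw [norm_fitSample_sub_sq w wh v _ Q hQ.symm]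
  have hz1 : Integrable (fun z : ℝ => z) (gaussianReal 0 (σ ^ 2)) :=
    (memLp_id_gaussianReal (μ := 0) (v := σ ^ 2) 1).integrable le_rfl
  have i1 := hQ.integral_inner_mul_inner_div hk (wh - w) (Q (w - v))
  have i2 := hQ.integral_inner_mul_inner_div hk (wh - w) (wh - w)
  have i3 := hQ.integral_inv_norm_sq hk
  have i4 : Integrable (fun x => 2 * (⟪x, Q (w - v)⟫ + ⟪x, wh - w⟫) / ‖Q x‖ ^ 2)
      (stdGaussian (Vec p)) := by
    refine ((hQ.integrable_inner_div hk (Q (w - v) + (wh - w))).const_mul 2).congr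
      (Filter.Eventually.of_forall fun x => ?_)
    simp only [inner_add_right]
    ring
  have j1 := (i1.1.comp_fst (gaussianReal 0 (σ ^ 2))).const_mul 2
  have j2 := i2.1.comp_fst (gaussianReal 0 (σ ^ 2))
  have j3 := i4.mul_prod hz1
  have j4 := i3.1.mul_prod (integrable_sq_gaussianReal (σ ^ 2))
  have j0 := integrable_const (μ := (stdGaussian (Vec p)).prod (gaussianReal 0 (σ ^ 2)))
    (‖w - v‖ ^ 2)
  refine ⟨(((j0.fun_add j1).fun_add j2).fun_add j3).fun_add j4, ?_⟩
  rw [integral_add (((j0.fun_add j1).fun_add j2).fun_add j3) j4,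
    integral_add ((j0.fun_add j1).fun_add j2) j3,
    integral_add (j0.fun_add j1) j2, integral_add j0 j1, integral_const_mul,
    integral_fun_fst (fun x => ⟪x, wh - w⟫ * ⟪x, Q (w - v)⟫ / ‖Q x‖ ^ 2),
    integral_fun_fst (fun x => ⟪x, wh - w⟫ * ⟪x, wh - w⟫ / ‖Q x‖ ^ 2),
    integral_prod_mul (fun x => 2 * (⟪x, Q (w - v)⟫ + ⟪x, wh - w⟫) / ‖Q x‖ ^ 2) (fun z : ℝ => z),
    integral_prod_mul (fun x => (‖Q x‖ ^ 2)⁻¹) (fun z : ℝ => z ^ 2),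
    i1.2, i2.2, i3.2.1, integral_sq_gaussianReal]
  have e1 : Q (wh - v) = Q (wh - w) + Q (w - v) := by rw [← map_add]; congr 1; abel
  have e2 : Q (w - wh) = -Q (wh - w) := by rw [← map_neg]; congr 1; abel
  have e3 : ⟪wh - w, Q (w - v)⟫ = ⟪Q (wh - w), Q (w - v)⟫ := by
    rw [hQ.inner_apply_apply, hQ.symm]
  have hz : ∫ z, z ∂gaussianReal 0 (σ ^ 2) = 0 := integral_id_gaussianReal
  rw [e1, e2, norm_add_sq_real, norm_neg, hQ.idem, e3, norm_sub_rev w wh, hz,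
    real_inner_self_eq_norm_sq, real_inner_self_eq_norm_sq]
  simp
  ring

end Rehearsal

/-! ### Independence of a fresh sample from the past. -/

namespace Rehearsal

/-- Averaging over `U` with `Y` frozen. Because `f` is nonnegative, Tonelli needs no joint
integrability; that of `g` implies it. -/
lemma integral_eq_of_slices_of_indepFun {Ω α β : Type*} [MeasurableSpace Ω] [MeasurableSpace α]
    [MeasurableSpace β] {P : Measure Ω} [IsProbabilityMeasure P] {Y : Ω → α} {U : Ω → β}
    (hYU : IndepFun Y U P) (hY : Measurable Y) (hU : Measurable U) {f : α × β → ℝ}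
    (hf : Measurable f) (hf0 : ∀ a, 0 ≤ f a) {g : α → ℝ}
    (hg : ∀ᵐ ω ∂P, Integrable (fun u => f (Y ω, u)) (P.map U) ∧
      ∫ u, f (Y ω, u) ∂(P.map U) = g (Y ω))
    (hgi : Integrable (fun ω => g (Y ω)) P) :
    Integrable (fun ω => f (Y ω, U ω)) P ∧ ∫ ω, f (Y ω, U ω) ∂P = ∫ ω, g (Y ω) ∂P := by
  have hg0 : ∀ᵐ ω ∂P, 0 ≤ g (Y ω) := by
    filter_upwards [hg] with ω h
    rw [← h.2]
    exact integral_nonneg fun u => hf0 _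
  have hm : Measurable fun ω => f (Y ω, U ω) := hf.comp (hY.prodMk hU)
  have hprob := Measure.isProbabilityMeasure_map (μ := P) hU.aemeasurable
  have key : ∫⁻ ω, ENNReal.ofReal (f (Y ω, U ω)) ∂P = ∫⁻ ω, ENNReal.ofReal (g (Y ω)) ∂P := by
    have hf' : Measurable fun a => ENNReal.ofReal (f a) := hf.ennreal_ofReal
    rw [← lintegral_map (f := fun a : α × β => ENNReal.ofReal (f a)) hf' (hY.prodMk hU),
      (indepFun_iff_map_prod_eq_prod_map_map hY.aemeasurable hU.aemeasurable).1 hYU,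
      lintegral_prod _ hf'.aemeasurable,
      lintegral_map (f := fun a => ∫⁻ u, ENNReal.ofReal (f (a, u)) ∂(P.map U))
        hf'.lintegral_prod_right' hY]
    refine lintegral_congr_ae ?_
    filter_upwards [hg] with ω h
    rw [← h.2, ofReal_integral_eq_lintegral_ofReal h.1 (Filter.Eventually.of_forall fun _ => hf0 _)]
  refine ⟨⟨hm.aestronglyMeasurable, ?_⟩, ?_⟩
  · rw [hasFiniteIntegral_iff_ofReal (Filter.Eventually.of_forall fun _ => hf0 _), key,
      ← hasFiniteIntegral_iff_ofReal hg0]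
    exact hgi.2
  · rw [integral_eq_lintegral_of_nonneg_ae (Filter.Eventually.of_forall fun _ => hf0 _)
      hm.aestronglyMeasurable, key, integral_eq_lintegral_of_nonneg_ae hg0 hgi.1]

section Data

variable {Ω : Type*} {T n M p : ℕ} {σ : ℝ≥0} {X : Sample T n M → Ω → Vec p} {z : Sample T n M → Ω → ℝ}

/-- The σ-algebra generated by the features and noises of the samples in `B`. -/
abbrev sigmaOf (X : Sample T n M → Ω → Vec p) (z : Sample T n M → Ω → ℝ) (B : Set (Sample T n M)) :
    MeasurableSpace Ω :=
  ⨆ q ∈ {q : Sample T n M × Fin p ⊕ Sample T n M | Sum.elim Prod.fst id q ∈ B},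
    (inferInstance : MeasurableSpace ℝ).comap
      (Sum.elim (fun (q : Sample T n M × Fin p) (ω : Ω) => X q.1 ω q.2) z q)

lemma measurable_vec_of_coord {m : MeasurableSpace Ω} {f : Ω → Vec p}
    (h : ∀ k, Measurable[m] fun ω => f ω k) : Measurable[m] f :=
  (WithLp.measurable_toLp 2 (Fin p → ℝ)).comp (measurable_pi_iff.2 h)

lemma sigmaOf_mono {B B' : Set (Sample T n M)} (h : B ⊆ B') : sigmaOf X z B ≤ sigmaOf X z B' :=
  biSup_mono fun _ hq => h hq

lemma sigmaOf_le [mΩ : MeasurableSpace Ω] (hX : ∀ s, Measurable (X s)) (hz : ∀ s, Measurable (z s))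
    (B : Set (Sample T n M)) : sigmaOf X z B ≤ mΩ := by
  refine iSup₂_le fun q _ => ?_
  rcases q with q | q
  · exact (show Measurable fun ω => X q.1 ω q.2 by have := hX q.1; fun_prop).comap_le
  · exact (hz q).comap_le

lemma measurable_feature_sigmaOf {B : Set (Sample T n M)} {s : Sample T n M} (hs : s ∈ B) :
    Measurable[sigmaOf X z B] (X s) := by
  refine measurable_vec_of_coord fun k => ?_
  rw [measurable_iff_comap_le]
  exact le_iSup₂_of_le (f := fun q (_ : q ∈ {q : Sample T n M × Fin p ⊕ Sample T n M |
    Sum.elim Prod.fst id q ∈ B}) => (inferInstance : MeasurableSpace ℝ).comap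
      (Sum.elim (fun (q : Sample T n M × Fin p) (ω : Ω) => X q.1 ω q.2) z q))
    (Sum.inl (s, k)) hs le_rfl

lemma measurable_noise_sigmaOf {B : Set (Sample T n M)} {s : Sample T n M} (hs : s ∈ B) :
    Measurable[sigmaOf X z B] (z s) := by
  rw [measurable_iff_comap_le]
  exact le_iSup₂_of_le (f := fun q (_ : q ∈ {q : Sample T n M × Fin p ⊕ Sample T n M |
    Sum.elim Prod.fst id q ∈ B}) => (inferInstance : MeasurableSpace ℝ).comap
      (Sum.elim (fun (q : Sample T n M × Fin p) (ω : Ω) => X q.1 ω q.2) z q))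
    (Sum.inr s) hs le_rfl

lemma IsGaussianData.measurable_coord [MeasurableSpace Ω] (hX : ∀ s, Measurable (X s))
    (hz : ∀ s, Measurable (z s))
    (q : Sample T n M × Fin p ⊕ Sample T n M) :
    Measurable (Sum.elim (fun (q : Sample T n M × Fin p) (ω : Ω) => X q.1 ω q.2) z q) := by
  rcases q with q | q
  · have := hX q.1
    simp only [Sum.elim_inl]
    fun_prop
  · exact hz q

/-- Disjoint sets of the independent scalar variables generate independent σ-algebras, and the state
after training on `B` is measurable for the one generated by `B`. -/
lemma IsGaussianData.indepFun_sample [MeasurableSpace Ω] {P : Measure Ω}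
    (hD : IsGaussianData P σ X z) (hX : ∀ s, Measurable (X s))
    (hz : ∀ s, Measurable (z s)) {B : Set (Sample T n M)} {b : Sample T n M} (hb : b ∉ B)
    {α : Type*} [MeasurableSpace α] {Y : Ω → α} (hY : Measurable[sigmaOf X z B] Y) :
    IndepFun Y (fun ω => (X b ω, z b ω)) P := by
  have h := indep_iSup_of_disjoint (fun q => (measurable_coord hX hz q).comap_le) hD.indep.iIndep
    (S := {q | Sum.elim Prod.fst id q ∈ B}) (T := {q | Sum.elim Prod.fst id q ∈ ({b} : Set _)})
    (Set.disjoint_left.2 fun q h1 h2 => hb (by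
      have h3 : Sum.elim Prod.fst id q = b := h2
      have h4 : Sum.elim Prod.fst id q ∈ B := h1
      rwa [h3] at h4))
  have hXb := measurable_feature_sigmaOf (X := X) (z := z) (Set.mem_singleton b)
  have hzb := measurable_noise_sigmaOf (X := X) (z := z) (Set.mem_singleton b)
  exact indep_of_indep_of_le_left (indep_of_indep_of_le_right h (hXb.prodMk hzb).comap_le)
    hY.comap_le

lemma IsGaussianData.map_feature [MeasurableSpace Ω] {P : Measure Ω}
    (hD : IsGaussianData P σ X z) (hX : ∀ s, Measurable (X s))
    (b : Sample T n M) : P.map (X b) = stdGaussian (Vec p) := by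
  have h1 : iIndepFun (fun (k : Fin p) ω => X b ω k) P :=
    hD.indep.precomp (g := fun k : Fin p => Sum.inl (b, k)) (fun i j h => by simpa using h)
  have hm : ∀ k : Fin p, Measurable fun ω => X b ω k := fun k => by have := hX b; fun_prop
  have h2 := h1.map_fun_eq_pi_map fun k => (hm k).aemeasurable
  simp_rw [fun k => (hD.law_feature b k).map_eq] at h2
  rw [← map_pi_eq_stdGaussian, ← h2, Measure.map_map (by fun_prop) (measurable_pi_iff.2 hm)]
  rfl

lemma IsGaussianData.map_sample [MeasurableSpace Ω] {P : Measure Ω}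
    [IsProbabilityMeasure P] (hD : IsGaussianData P σ X z) (hX : ∀ s, Measurable (X s))
    (hz : ∀ s, Measurable (z s)) (b : Sample T n M) :
    P.map (fun ω => (X b ω, z b ω)) = (stdGaussian (Vec p)).prod (gaussianReal 0 (σ ^ 2)) := by
  have h := indep_iSup_of_disjoint (fun q => (measurable_coord hX hz q).comap_le) hD.indep.iIndep
    (S := Set.range Sum.inl) (T := Set.range Sum.inr)
    (Set.disjoint_left.2 fun q h1 h2 => by
      obtain ⟨a, rfl⟩ := h1; obtain ⟨c, hc⟩ := h2; cases hc)
  have hle : ∀ (S : Set (Sample T n M × Fin p ⊕ Sample T n M)) q, q ∈ S →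
      Measurable[⨆ q ∈ S, (inferInstance : MeasurableSpace ℝ).comap
        (Sum.elim (fun (q : Sample T n M × Fin p) (ω : Ω) => X q.1 ω q.2) z q)]
        (Sum.elim (fun (q : Sample T n M × Fin p) (ω : Ω) => X q.1 ω q.2) z q) := by
    intro S q hq
    rw [measurable_iff_comap_le]
    exact le_iSup₂_of_le (f := fun q (_ : q ∈ S) => (inferInstance : MeasurableSpace ℝ).comap
      (Sum.elim (fun (q : Sample T n M × Fin p) (ω : Ω) => X q.1 ω q.2) z q)) q hq le_rfl
  have hXb := measurable_vec_of_coord (f := X b) fun k => hle (Set.range Sum.inl) _ ⟨(b, k), rfl⟩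
  have hzb := hle (Set.range Sum.inr) _ ⟨b, rfl⟩
  have hind : IndepFun (X b) (z b) P :=
    indep_of_indep_of_le_left (indep_of_indep_of_le_right h hzb.comap_le) hXb.comap_le
  rw [(indepFun_iff_map_prod_eq_prod_map_map (hX b).aemeasurable (hz b).aemeasurable).1 hind,
    hD.map_feature hX, (hD.law_noise b).map_eq]

lemma measurable_fitSample : Measurable fun a : (Vec p × (Vec p →L[ℝ] Vec p)) × (Vec p × ℝ) =>
    fitSample a.1.1 a.1.2 a.2.1 a.2.2 := by
  unfold fitSample
  have h : Measurable fun a : (Vec p × (Vec p →L[ℝ] Vec p)) × (Vec p × ℝ) => a.1.2 a.2.1 := by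
    have : Continuous fun a : (Vec p × (Vec p →L[ℝ] Vec p)) × (Vec p × ℝ) => a.1.2 a.2.1 := by
      fun_prop
    exact this.measurable
  fun_prop

lemma measurable_deflate : Measurable fun a : (Vec p × (Vec p →L[ℝ] Vec p)) × (Vec p × ℝ) =>
    deflate a.1.2 a.2.1 := by
  unfold deflate
  have h : Continuous fun a : (Vec p × (Vec p →L[ℝ] Vec p)) × (Vec p × ℝ) => a.1.2 a.2.1 := by
    fun_prop
  have h2 : Continuous fun x : Vec p => (innerSL ℝ x).smulRight x := by fun_prop
  have h3 := (h2.comp h).measurable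
  have h4 := h.measurable
  exact (by fun_prop : Measurable fun a : (Vec p × (Vec p →L[ℝ] Vec p)) × (Vec p × ℝ) => a.1.2).sub
    ((h4.norm.pow_const 2).inv.smul h3)

end Data

end Rehearsal

/-! ### Exact expected errors after training on a finite set of samples. -/

namespace Rehearsal

/-- Sum of the squared distances of the ground truths of the samples in `A` to that of task `i`. -/
noncomputable def truthDist {T n M p : ℕ} (wstar : Fin T → Vec p) (A : Finset (Sample T n M))
    (i : Fin T) : ℝ :=
  ∑ s ∈ A, ‖wstar (taskOf s) - wstar i‖ ^ 2

/-- Sum of the squared distances of the ground truths over all unordered pairs of samples in `A`. -/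
noncomputable def truthSpread {T n M p : ℕ} (wstar : Fin T → Vec p) (A : Finset (Sample T n M)) :
    ℝ :=
  (∑ s ∈ A, truthDist wstar A (taskOf s)) / 2

lemma truthDist_insert {T n M p : ℕ} (wstar : Fin T → Vec p) {A : Finset (Sample T n M)}
    {b : Sample T n M} (hb : b ∉ A) (i : Fin T) :
    truthDist wstar (insert b A) i = truthDist wstar A i + ‖wstar (taskOf b) - wstar i‖ ^ 2 := by
  rw [truthDist, Finset.sum_insert hb, add_comm, truthDist]

lemma truthSpread_insert {T n M p : ℕ} (wstar : Fin T → Vec p) {A : Finset (Sample T n M)}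
    {b : Sample T n M} (hb : b ∉ A) :
    truthSpread wstar (insert b A) = truthSpread wstar A + truthDist wstar A (taskOf b) := by
  have h : ∑ s ∈ A, ‖wstar (taskOf b) - wstar (taskOf s)‖ ^ 2 = truthDist wstar A (taskOf b) := by
    simp_rw [truthDist, norm_sub_rev]
  simp_rw [truthSpread, truthDist_insert wstar hb]
  rw [Finset.sum_insert hb, Finset.sum_add_distrib, h]
  simp
  ring

/-- `(W, R)` are the parameters `W` fitted to the samples in `A`, starting from `w₀`, and the
projection `R` onto the orthogonal complement of the span of the features. -/
structure IsFit {S : Type*} {p : ℕ} (x : S → Vec p) (y : S → ℝ) (A : Finset S) (w₀ W : Vec p)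
    (R : Vec p →L[ℝ] Vec p) (k : ℕ) : Prop where
  proj : IsOrthProj R k
  interp : ∀ s ∈ A, ⟪x s, W⟫ = y s
  ker : ∀ s ∈ A, R (x s) = 0
  orth : ∀ u, (∀ s ∈ A, ⟪x s, u⟫ = 0) → ⟪W - w₀, u⟫ = 0
  fix : ∀ u, (∀ s ∈ A, ⟪x s, u⟫ = 0) → R u = u

/-- For an interpolator `v`, the difference `v - W` is orthogonal to all features, hence to `W -
w₀`, and Pythagoras applies. -/
lemma IsFit.isNearest {S : Type*} {p : ℕ} {x : S → Vec p} {y : S → ℝ} {A : Finset S}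
    {w₀ W : Vec p} {R : Vec p →L[ℝ] Vec p} {k : ℕ} (h : IsFit x y A w₀ W R k) :
    IsNearest (interpolators x y A) w₀ W := by
  refine ⟨fun s hs => h.interp s (by simpa using hs), fun v hv => ?_⟩
  have h1 := h.orth (v - W) fun s hs => by
    rw [inner_sub_right, hv s (by simpa using hs), h.interp s hs, sub_self]
  have e : v - w₀ = (W - w₀) + (v - W) := by abel
  change ‖W - w₀‖ ^ 2 ≤ ‖v - w₀‖ ^ 2
  rw [e, norm_add_sq_real, h1]
  nlinarith [sq_nonneg ‖v - W‖]

lemma IsFit.train_eq {S : Type*} {p : ℕ} {x : S → Vec p} {y : S → ℝ} {A : Finset S}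
    {w₀ W : Vec p} {R : Vec p →L[ℝ] Vec p} {k : ℕ} (h : IsFit x y A w₀ W R k) :
    train x y A w₀ = W := by
  have hex : ∃ w, IsNearest (interpolators x y A) w₀ w := ⟨W, h.isNearest⟩
  rw [train, dif_pos hex]
  exact (existsUnique_isNearest x y A ⟨W, h.isNearest.1⟩ w₀).unique hex.choose_spec h.isNearest

lemma IsFit.insert {S : Type*} [DecidableEq S] {p : ℕ} {x : S → Vec p} {y : S → ℝ} {A : Finset S}
    {w₀ W : Vec p} {R : Vec p →L[ℝ] Vec p} {k : ℕ} (h : IsFit x y A w₀ W R (k + 1)) {b : S}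
    (hb : R (x b) ≠ 0) :
    IsFit x y (insert b A) w₀ (fitSample W R (x b) (y b)) (deflate R (x b)) k where
  proj := h.proj.deflate hb
  interp s hs := by
    have hn : ‖R (x b)‖ ^ 2 ≠ 0 := by simpa using hb
    rw [fitSample, inner_add_right, inner_smul_right]
    rcases Finset.mem_insert.1 hs with rfl | hs
    · rw [← h.proj.symm, ← h.proj.inner_apply_apply, real_inner_self_eq_norm_sq,
        div_mul_cancel₀ _ hn]
      ring
    · rw [← h.proj.symm, h.ker s hs, inner_zero_left, mul_zero, add_zero, h.interp s hs]
  ker s hs := by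
    have hn : ‖R (x b)‖ ^ 2 ≠ 0 := by simpa using hb
    rw [deflate_apply]
    rcases Finset.mem_insert.1 hs with rfl | hs
    · rw [← h.proj.inner_apply_apply, real_inner_self_eq_norm_sq, div_self hn, one_smul, sub_self]
    · rw [h.proj.symm, h.ker s hs]
      simp
  orth u hu := by
    have h1 := fun s hs => hu s (Finset.mem_insert_of_mem hs)
    rw [fitSample, add_sub_right_comm, inner_add_left, h.orth u h1, inner_smul_left, h.proj.symm,
      h.fix u h1, hu b (Finset.mem_insert_self _ _)]
    simp
  fix u hu := by
    have h1 := fun s hs => hu s (Finset.mem_insert_of_mem hs)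
    rw [deflate_apply, h.proj.symm, h.fix u h1, hu b (Finset.mem_insert_self _ _)]
    simp

section Data

variable {Ω : Type*} [MeasurableSpace Ω] {P : Measure Ω} [IsProbabilityMeasure P]
  {T n M p : ℕ} {σ : ℝ≥0} {X : Sample T n M → Ω → Vec p} {z : Sample T n M → Ω → ℝ}
  {wstar : Fin T → Vec p}

/-- The one-sample formulas averaged over the random state. Three families of expectations occur
together because the recursion for the error involves the projected error and the projected
differences of truths. -/
lemma IsGaussianData.integral_norm_fitSample (hD : IsGaussianData P σ X z)
    (hX : ∀ s, Measurable (X s)) (hz : ∀ s, Measurable (z s)) {B : Set (Sample T n M)}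
    {b : Sample T n M} (hb : b ∉ B) {W : Ω → Vec p} {R : Ω → Vec p →L[ℝ] Vec p}
    (hW : Measurable[sigmaOf X z B] W) (hR : Measurable[sigmaOf X z B] R) {k : ℕ} (hk : 3 ≤ k)
    (hRk : ∀ᵐ ω ∂P, IsOrthProj (R ω) k)
    (h1 : ∀ i, Integrable (fun ω => ‖W ω - wstar i‖ ^ 2) P)
    (h2 : ∀ i, Integrable (fun ω => ‖R ω (W ω - wstar i)‖ ^ 2) P)
    (h3 : ∀ h i, Integrable (fun ω => ‖R ω (wstar h - wstar i)‖ ^ 2) P) :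
    (∀ᵐ ω ∂P, R ω (X b ω) ≠ 0) ∧
    (∀ i, Integrable (fun ω => ‖fitSample (W ω) (R ω) (X b ω)
        (label wstar (fun s => X s ω) (fun s => z s ω) b) - wstar i‖ ^ 2) P ∧
      ∫ ω, ‖fitSample (W ω) (R ω) (X b ω)
        (label wstar (fun s => X s ω) (fun s => z s ω) b) - wstar i‖ ^ 2 ∂P =
      (∫ ω, ‖W ω - wstar i‖ ^ 2 ∂P) - (∫ ω, ‖R ω (W ω - wstar i)‖ ^ 2 ∂P) / k +
        (∫ ω, ‖R ω (wstar (taskOf b) - wstar i)‖ ^ 2 ∂P) / k +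
        ((∫ ω, ‖W ω - wstar (taskOf b)‖ ^ 2 ∂P) -
          ∫ ω, ‖R ω (W ω - wstar (taskOf b))‖ ^ 2 ∂P) / ((k : ℝ) - 2) +
        (σ : ℝ) ^ 2 / ((k : ℝ) - 2)) ∧
    (∀ i, Integrable (fun ω => ‖deflate (R ω) (X b ω) (W ω - wstar i)‖ ^ 2) P ∧
      ∫ ω, ‖deflate (R ω) (X b ω) (W ω - wstar i)‖ ^ 2 ∂P =
        (1 - 1 / k) * ∫ ω, ‖R ω (W ω - wstar i)‖ ^ 2 ∂P) ∧
    (∀ h i, Integrable (fun ω => ‖deflate (R ω) (X b ω) (wstar h - wstar i)‖ ^ 2) P ∧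
      ∫ ω, ‖deflate (R ω) (X b ω) (wstar h - wstar i)‖ ^ 2 ∂P =
        (1 - 1 / k) * ∫ ω, ‖R ω (wstar h - wstar i)‖ ^ 2 ∂P) := by
  have hle := sigmaOf_le hX hz B
  have hY := hW.prodMk hR
  have hind := hD.indepFun_sample hX hz hb hY
  have hY' : Measurable fun ω => (W ω, R ω) := hY.mono hle le_rfl
  have hU : Measurable fun ω => (X b ω, z b ω) := (hX b).prodMk (hz b)
  have hlaw := hD.map_sample hX hz b
  have happ : Measurable fun a : (Vec p × (Vec p →L[ℝ] Vec p)) × (Vec p × ℝ) => a.1.2 a.2.1 := by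
    have : Continuous fun a : (Vec p × (Vec p →L[ℝ] Vec p)) × (Vec p × ℝ) => a.1.2 a.2.1 := by
      fun_prop
    exact this.measurable
  have hdefl : ∀ (v : Vec p × (Vec p →L[ℝ] Vec p) → Vec p), Measurable v →
      (Integrable (fun ω => ‖R ω (v (W ω, R ω))‖ ^ 2) P) →
      Integrable (fun ω => ‖deflate (R ω) (X b ω) (v (W ω, R ω))‖ ^ 2) P ∧
      ∫ ω, ‖deflate (R ω) (X b ω) (v (W ω, R ω))‖ ^ 2 ∂P =
        (1 - 1 / k) * ∫ ω, ‖R ω (v (W ω, R ω))‖ ^ 2 ∂P := by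
    intro v hv hint
    have hf : Measurable fun a : (Vec p × (Vec p →L[ℝ] Vec p)) × (Vec p × ℝ) =>
        ‖deflate a.1.2 a.2.1 (v a.1)‖ ^ 2 := by
      have h1 : Continuous fun a : (Vec p →L[ℝ] Vec p) × Vec p => a.1 a.2 := by fun_prop
      exact (h1.measurable.comp
        (measurable_deflate.prodMk (hv.comp measurable_fst))).norm.pow_const 2
    have := integral_eq_of_slices_of_indepFun hind hY' hU hf (fun _ => sq_nonneg _)
      (g := fun a => (1 - 1 / k) * ‖a.2 (v a)‖ ^ 2) (by
        filter_upwards [hRk] with ω hω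
        rw [hlaw]
        have h := hω.integral_norm_deflate_sq hk (v (W ω, R ω))
        refine ⟨h.1.comp_fst _, ?_⟩
        have e := integral_fun_fst (μ := stdGaussian (Vec p)) (ν := gaussianReal 0 (σ ^ 2))
          (fun x => ‖deflate (R ω) x (v (W ω, R ω))‖ ^ 2)
        rw [h.2] at e
        simpa using e) (hint.const_mul _)
    rw [integral_const_mul] at this
    exact this
  refine ⟨?_, fun i => ?_, fun i => hdefl (fun a => a.1 - wstar i) (by fun_prop) (h2 i),
    fun h i => hdefl (fun _ => wstar h - wstar i) (by fun_prop) (h3 h i)⟩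
  · have hms : MeasurableSet {a : (Vec p × (Vec p →L[ℝ] Vec p)) × (Vec p × ℝ) | a.1.2 a.2.1 = 0} :=
      happ (measurableSet_singleton 0)
    -- The event that the new feature lies in the kernel of `R` is handled through its indicator:
    -- every slice has integral zero.
    have := integral_eq_of_slices_of_indepFun hind hY' hU
      (f := Set.indicator {a : (Vec p × (Vec p →L[ℝ] Vec p)) × (Vec p × ℝ) | a.1.2 a.2.1 = 0}
        fun _ => (1 : ℝ)) (measurable_const.indicator hms)
      (fun _ => Set.indicator_nonneg (fun _ _ => zero_le_one) _) (g := fun _ => 0) (by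
        filter_upwards [hRk] with ω hω
        rw [hlaw]
        have h := (hω.integral_inv_norm_sq hk).2.2
        have h0 : (fun u : Vec p × ℝ => Set.indicator
            {a : (Vec p × (Vec p →L[ℝ] Vec p)) × (Vec p × ℝ) | a.1.2 a.2.1 = 0}
            (fun _ => (1 : ℝ)) ((W ω, R ω), u)) =ᵐ[(stdGaussian (Vec p)).prod
              (gaussianReal 0 (σ ^ 2))] fun _ => 0 := by
          filter_upwards [Measure.quasiMeasurePreserving_fst.ae h] with u hu
          simpa [Set.indicator] using hu
        exact ⟨(integrable_zero _ _ _).congr h0.symm, by rw [integral_congr_ae h0]; simp⟩)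
      (integrable_zero _ _ _)
    have h0 := (integral_eq_zero_iff_of_nonneg
      (fun _ => Set.indicator_nonneg (fun _ _ => zero_le_one) _) this.1).1 (by
        rw [this.2]; simp)
    filter_upwards [h0] with ω hω hcon
    simp [Set.indicator, hcon] at hω
  · have hf : Measurable fun a : (Vec p × (Vec p →L[ℝ] Vec p)) × (Vec p × ℝ) =>
        ‖fitSample a.1.1 a.1.2 a.2.1 (⟪a.2.1, wstar (taskOf b)⟫ + a.2.2) - wstar i‖ ^ 2 := by
      have h1 : Measurable fun a : (Vec p × (Vec p →L[ℝ] Vec p)) × (Vec p × ℝ) =>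
          (a.1, (a.2.1, ⟪a.2.1, wstar (taskOf b)⟫ + a.2.2)) := by fun_prop
      exact ((measurable_fitSample.comp h1).sub_const _).norm.pow_const 2
    have hA := Integrable.sub' (h1 i) ((h2 i).div_const (k : ℝ))
    have hB := hA.fun_add ((h3 (taskOf b) i).div_const (k : ℝ))
    have hC := (Integrable.sub' (h1 (taskOf b)) (h2 (taskOf b))).div_const ((k : ℝ) - 2)
    have hE := integrable_const (μ := P) ((σ : ℝ) ^ 2 / ((k : ℝ) - 2))
    have := integral_eq_of_slices_of_indepFun hind hY' hU hf (fun _ => sq_nonneg _)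
      (g := fun a => ‖a.1 - wstar i‖ ^ 2 - ‖a.2 (a.1 - wstar i)‖ ^ 2 / k +
        ‖a.2 (wstar (taskOf b) - wstar i)‖ ^ 2 / k +
        (‖a.1 - wstar (taskOf b)‖ ^ 2 - ‖a.2 (a.1 - wstar (taskOf b))‖ ^ 2) / ((k : ℝ) - 2) +
        (σ : ℝ) ^ 2 / ((k : ℝ) - 2)) (by
        filter_upwards [hRk] with ω hω
        rw [hlaw]
        exact hω.integral_norm_fitSample_sub_sq hk σ (W ω) (wstar (taskOf b)) (wstar i))
      ((hB.fun_add hC).fun_add hE)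
    rw [integral_add (hB.fun_add hC) hE, integral_add hB hC,
      integral_add hA ((h3 (taskOf b) i).div_const (k : ℝ)),
      integral_sub (h1 i) ((h2 i).div_const (k : ℝ)), integral_div, integral_div, integral_div,
      integral_sub (h1 (taskOf b)) (h2 (taskOf b)), integral_const] at this
    simpa [label] using this

/-- Existence of a measurable version of training on the samples in `A` from `w₀`, with the exact
expected model errors. -/
lemma IsGaussianData.exists_fit (hD : IsGaussianData P σ X z)
    (hX : ∀ s, Measurable (X s)) (hz : ∀ s, Measurable (z s)) {B : Set (Sample T n M)}
    {w₀ : Ω → Vec p} (hw₀ : Measurable[sigmaOf X z B] w₀)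
    (hint : ∀ i, Integrable (fun ω => ‖w₀ ω - wstar i‖ ^ 2) P) (A : Finset (Sample T n M)) :
    Disjoint B A → A.card + 2 ≤ p →
    ∃ (W : Ω → Vec p) (R : Ω → Vec p →L[ℝ] Vec p),
      Measurable[sigmaOf X z (B ∪ A)] W ∧ Measurable[sigmaOf X z (B ∪ A)] R ∧
      (∀ᵐ ω ∂P, IsFit (fun s => X s ω) (label wstar (fun s => X s ω) (fun s => z s ω)) A
        (w₀ ω) (W ω) (R ω) (p - A.card)) ∧
      (∀ i, Integrable (fun ω => ‖W ω - wstar i‖ ^ 2) P ∧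
        ∫ ω, ‖W ω - wstar i‖ ^ 2 ∂P = (1 - A.card / p) * ∫ ω, ‖w₀ ω - wstar i‖ ^ 2 ∂P +
          (truthDist wstar A i + truthSpread wstar A / ((p : ℝ) - A.card - 1)) / p +
          A.card * (σ : ℝ) ^ 2 / ((p : ℝ) - A.card - 1)) ∧
      (∀ i, Integrable (fun ω => ‖R ω (W ω - wstar i)‖ ^ 2) P ∧
        ∫ ω, ‖R ω (W ω - wstar i)‖ ^ 2 ∂P = (1 - A.card / p) * ∫ ω, ‖w₀ ω - wstar i‖ ^ 2 ∂P) ∧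
      (∀ h i, Integrable (fun ω => ‖R ω (wstar h - wstar i)‖ ^ 2) P ∧
        ∫ ω, ‖R ω (wstar h - wstar i)‖ ^ 2 ∂P = (1 - A.card / p) * ‖wstar h - wstar i‖ ^ 2) := by
  classical
  induction A using Finset.induction_on with
  | empty =>
    intro _ _
    refine ⟨w₀, fun _ => ContinuousLinearMap.id ℝ (Vec p),
      hw₀.mono (sigmaOf_mono Set.subset_union_left) le_rfl,
      measurable_const,
      Filter.Eventually.of_forall fun ω => ⟨by simpa using isOrthProj_id, by simp, by simp,
        by simp, by simp⟩, fun i => ⟨hint i, by simp [truthDist, truthSpread]⟩,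
        fun i => ⟨hint i, by simp⟩, fun h i => ⟨integrable_const _, by simp⟩⟩
  | insert b A hb ih =>
    intro hdisj hcard
    rw [Finset.card_insert_of_notMem hb] at hcard ⊢
    rw [Finset.coe_insert, Set.disjoint_insert_right] at hdisj
    obtain ⟨W, R, hW, hR, hfit, h1, h2, h3⟩ := ih hdisj.2 (by omega)
    obtain ⟨k, hk⟩ : ∃ k, p - A.card = k + 1 := ⟨p - A.card - 1, by omega⟩
    have hbn : b ∉ B ∪ A := by simpa [hb] using hdisj.1
    -- The two spare dimensions leave rank at least `3` before each insertion, which makes `1 /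
    -- (rank - 2)` finite.
    obtain ⟨g0, g1, g2, g3⟩ := hD.integral_norm_fitSample hX hz hbn hW hR (k := k + 1) (by omega)
      (by filter_upwards [hfit] with ω h; exact hk ▸ h.proj) (fun i => (h1 i).1)
      (fun i => (h2 i).1) (fun h i => (h3 h i).1)
    have hsub : B ∪ (A : Set (Sample T n M)) ⊆ B ∪ (insert b A : Finset (Sample T n M)) := by
      rw [Finset.coe_insert]; exact Set.union_subset_union_right _ (Set.subset_insert _ _)
    have hW' := hW.mono (sigmaOf_mono (X := X) (z := z) hsub) le_rfl
    have hR' := hR.mono (sigmaOf_mono (X := X) (z := z) hsub) le_rfl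
    have hbm : b ∈ B ∪ ((insert b A : Finset (Sample T n M)) : Set (Sample T n M)) := by simp
    have hXb := measurable_feature_sigmaOf (X := X) (z := z) hbm
    have hzb := measurable_noise_sigmaOf (X := X) (z := z) hbm
    have hyb : Measurable[sigmaOf X z (B ∪ (insert b A : Finset (Sample T n M)))]
        fun ω => label wstar (fun s => X s ω) (fun s => z s ω) b :=
      (Measurable.inner_const hXb).add hzb
    have hp : (p : ℝ) = k + 1 + A.card := by
      have : p = k + 1 + A.card := by omega
      exact_mod_cast this
    have hk2 : (2 : ℝ) ≤ k := by exact_mod_cast (by omega : 2 ≤ k)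
    have hp0 : (p : ℝ) ≠ 0 := by
      have : (0 : ℝ) ≤ A.card := Nat.cast_nonneg _
      rw [hp]; positivity
    have hk0 : (k : ℝ) ≠ 0 := by positivity
    have hk1 : (k : ℝ) + 1 ≠ 0 := by positivity
    have hk3 : (k : ℝ) - 1 ≠ 0 := by linarith
    have hA : (A.card : ℝ) = p - k - 1 := by linarith
    refine ⟨fun ω => fitSample (W ω) (R ω) (X b ω)
        (label wstar (fun s => X s ω) (fun s => z s ω) b), fun ω => deflate (R ω) (X b ω),
      measurable_fitSample.comp ((hW'.prodMk hR').prodMk (hXb.prodMk hyb)),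
      measurable_deflate.comp ((hW'.prodMk hR').prodMk (hXb.prodMk hzb)), ?_, ?_, ?_, ?_⟩
    · filter_upwards [hfit, g0] with ω hω h0
      rw [hk] at hω
      have := hω.insert h0
      rwa [show p - (A.card + 1) = k by omega]
    · intro i
      refine ⟨(g1 i).1, ?_⟩
      rw [(g1 i).2, (h1 i).2, (h2 i).2, (h3 _ i).2, (h1 (taskOf b)).2, (h2 (taskOf b)).2,
        truthDist_insert wstar hb, truthSpread_insert wstar hb]
      push_cast
      rw [hA]
      have e1 : (p : ℝ) - (p - k - 1) - 1 = k := by ring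
      have e2 : (p : ℝ) - (p - k - 1 + 1) - 1 = k - 1 := by ring
      have e3 : (k : ℝ) + 1 - 2 = k - 1 := by ring
      rw [e1, e2, e3]
      field_simp
      ring
    · intro i
      -- After deflation old and new parameters have the same projected error, so each step
      -- multiplies its mean by `1 - 1 / (k + 1)`; these factors telescope to `1 - m / p` after `m`
      -- samples.
      have e : ∀ᵐ ω ∂P, ‖deflate (R ω) (X b ω) (W ω - wstar i)‖ ^ 2 =
          ‖deflate (R ω) (X b ω) (fitSample (W ω) (R ω) (X b ω)
            (label wstar (fun s => X s ω) (fun s => z s ω) b) - wstar i)‖ ^ 2 := by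
        filter_upwards [hfit] with ω hω
        rw [hω.proj.deflate_fitSample]
      refine ⟨(g2 i).1.congr e, ?_⟩
      rw [← integral_congr_ae e, (g2 i).2, (h2 i).2]
      push_cast
      rw [hA]
      field_simp
      ring
    · intro h i
      refine ⟨(g3 h i).1, ?_⟩
      rw [(g3 h i).2, (h3 h i).2]
      push_cast
      rw [hA]
      field_simp
      ring

end Data

end Rehearsal

/-! ### Datasets as blocks, and the error recursions of both methods. -/

namespace Rehearsal

/-- The task during whose training a sample is used. -/
def stage {T n M : ℕ} : Sample T n M → ℕ
  | Sum.inl q => q.1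
  | Sum.inr q => q.1

/-- The position of the dataset of a sample in sequential rehearsal within a task. -/
def position {T n M : ℕ} : Sample T n M → ℕ
  | Sum.inl _ => 0
  | Sum.inr q => q.2.1 + 1

lemma currentData_eq (T n M t : ℕ) :
    currentData T n M t = {s | stage s = t ∧ position s = 0} := by
  ext s
  rcases s with q | q
  · constructor
    · rintro ⟨q', hq, h⟩
      cases Sum.inl.inj hq
      exact ⟨h, rfl⟩
    · rintro ⟨h, -⟩
      exact ⟨q, rfl, h⟩
  · simp [currentData, stage, position]

lemma memoryData_eq (T n M t h : ℕ) :
    memoryData T n M t h = {s | stage s = t ∧ position s = h + 1} := by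
  ext s
  rcases s with q | q
  · simp [memoryData, stage, position]
  · constructor
    · rintro ⟨q', hq, h1, h2⟩
      cases Sum.inr.inj hq
      exact ⟨h1, congrArg (· + 1) h2⟩
    · rintro ⟨h1, h2⟩
      exact ⟨q, rfl, h1, Nat.succ.inj h2⟩

lemma concurrentData_eq (T n M t : ℕ) :
    currentData T n M t ∪ ⋃ h < t, memoryData T n M t h = {s | stage s = t} := by
  ext s
  rw [currentData_eq]
  simp only [memoryData_eq, Set.mem_union, Set.mem_iUnion, Set.mem_ofPred_eq]
  constructor
  · rintro (h | ⟨h, -, h'⟩)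
    · exact h.1
    · exact h'.1
  · rintro rfl
    rcases s with q | q
    · exact Or.inl ⟨rfl, rfl⟩
    · exact Or.inr ⟨q.2.1, q.2.1.isLt, rfl, rfl⟩

lemma position_lt {T n M : ℕ} (s : Sample T n M) : position s < stage s + 1 := by
  rcases s with q | q
  · exact Nat.succ_pos _
  · exact Nat.succ_lt_succ q.2.1.isLt

/-- Size of the `k`-th dataset used while training on task `t`. -/
def blockSize (n M t k : ℕ) : ℕ := if k = 0 then n else M / t

/-- Task of the `k`-th dataset used while training on task `t`. -/
def blockTask (t k : ℕ) : ℕ := if k = 0 then t else k - 1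

lemma exists_block (T n M : ℕ) {t k : ℕ} (ht : t < T) (hk : k < t + 1) :
    ∃ A : Finset (Sample T n M), (A : Set (Sample T n M)) = {s | stage s = t ∧ position s = k} ∧
      A.card = blockSize n M t k ∧ ∀ s ∈ A, (taskOf s : ℕ) = blockTask t k := by
  classical
  rcases k with _ | h
  · refine ⟨Finset.univ.image fun c : Fin n => (Sum.inl (⟨t, ht⟩, c) : Sample T n M), ?_, ?_, ?_⟩
    · ext s
      rcases s with ⟨⟨a, ha⟩, c⟩ | q
      · constructor
        · intro hs
          obtain ⟨c', -, hc⟩ := Finset.mem_image.1 (Finset.mem_coe.1 hs)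
          cases hc
          exact ⟨rfl, rfl⟩
        · rintro ⟨h1, -⟩
          simp only [stage] at h1
          subst h1
          exact Finset.mem_coe.2 (Finset.mem_image.2 ⟨c, Finset.mem_univ _, rfl⟩)
      · simp [stage, position]
    · rw [Finset.card_image_of_injective _ fun a b hab => by simpa using hab]
      simp [blockSize]
    · intro s hs
      obtain ⟨c, -, rfl⟩ := Finset.mem_image.1 hs
      rfl
  · have hh : h < t := by omega
    refine ⟨Finset.univ.image fun c : Fin (M / t) =>
      (Sum.inr ⟨⟨t, ht⟩, (⟨h, hh⟩, c)⟩ : Sample T n M), ?_, ?_, ?_⟩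
    · ext s
      rcases s with q | ⟨⟨a, ha⟩, ⟨b, hb⟩, c⟩
      · simp [stage, position]
      · constructor
        · intro hs
          obtain ⟨c', -, hc⟩ := Finset.mem_image.1 (Finset.mem_coe.1 hs)
          cases hc
          exact ⟨rfl, rfl⟩
        · rintro ⟨h1, h2⟩
          simp only [stage] at h1
          simp only [position, add_left_inj] at h2
          subst h1; subst h2
          exact Finset.mem_coe.2 (Finset.mem_image.2 ⟨c, Finset.mem_univ _, rfl⟩)
    · rw [Finset.card_image_of_injective _ fun a b hab => by simpa using hab]
      simp [blockSize]
    · intro s hs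
      obtain ⟨c, -, rfl⟩ := Finset.mem_image.1 hs
      rfl

lemma exists_stage (T n M : ℕ) {t : ℕ} (ht : t < T) :
    ∃ A : Finset (Sample T n M), (A : Set (Sample T n M)) = {s | stage s = t} ∧
      ∀ f : ℕ → ℝ, ∑ s ∈ A, f (taskOf s) =
        ∑ k ∈ Finset.range (t + 1), (blockSize n M t k : ℝ) * f (blockTask t k) := by
  classical
  choose! A hA1 hA2 hA3 using fun k (hk : k < t + 1) => exists_block T n M ht hk
  refine ⟨(Finset.range (t + 1)).biUnion A, ?_, fun f => ?_⟩
  · ext s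
    simp only [Finset.coe_biUnion, Set.mem_iUnion, Set.mem_ofPred_eq, Finset.coe_range, Set.mem_Iio]
    constructor
    · rintro ⟨k, hk, hs⟩
      rw [hA1 k hk] at hs
      exact hs.1
    · rintro rfl
      refine ⟨position s, position_lt s, ?_⟩
      rw [hA1 _ (position_lt s)]
      exact ⟨rfl, rfl⟩
  · rw [Finset.sum_biUnion]
    · refine Finset.sum_congr rfl fun k hk => ?_
      have hk' := Finset.mem_range.1 hk
      rw [Finset.sum_congr rfl fun s hs => congrArg f (hA3 k hk' s hs), Finset.sum_const,
        hA2 k hk', nsmul_eq_mul]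
    · intro k hk l hl hkl
      rw [Function.onFun, ← Finset.disjoint_coe, hA1 k (by simpa using hk),
        hA1 l (by simpa using hl)]
      exact Set.disjoint_left.2 fun s h1 h2 => hkl (h1.2.symm.trans h2.2)

/-- Squared distance of the ground truths of two tasks. -/
noncomputable def taskDist (h i : ℕ) : ℝ := if h = i then 0 else 2

lemma norm_sub_sq_eq_taskDist {T p : ℕ} {wstar : Fin T → Vec p} (ho : Orthonormal ℝ wstar)
    (h i : Fin T) : ‖wstar h - wstar i‖ ^ 2 = taskDist h i := by
  rw [taskDist]
  split_ifs with hi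
  · rw [Fin.ext hi]; simp
  · rw [norm_sub_sq_real, ho.1, ho.1, ho.2 fun e => hi (congrArg _ e)]
    norm_num

/-- Expected model errors after training on the first `k` of a sequence of datasets of sizes `r`,
whose ground truths are at squared distances `τ` from that of the task considered. -/
noncomputable def chainError (p σ : ℝ) (r τ : ℕ → ℝ) (L : ℝ) : ℕ → ℝ
  | 0 => L
  | k + 1 => (1 - r k / p) * chainError p σ r τ L k + r k * τ k / p + r k * σ ^ 2 / (p - r k - 1)

/-- Expected model error after joint training on `K` datasets of different tasks. -/
noncomputable def jointError (p σ : ℝ) (r τ : ℕ → ℝ) (L : ℝ) (K : ℕ) : ℝ :=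
  (1 - (∑ k ∈ Finset.range K, r k) / p) * L +
    (∑ k ∈ Finset.range K, r k * τ k + ((∑ k ∈ Finset.range K, r k) ^ 2 -
      ∑ k ∈ Finset.range K, r k ^ 2) / (p - ∑ k ∈ Finset.range K, r k - 1)) / p +
    (∑ k ∈ Finset.range K, r k) * σ ^ 2 / (p - ∑ k ∈ Finset.range K, r k - 1)

/-- Expected model error of sequential rehearsal over task `i` after `t` tasks. -/
noncomputable def sequentialError (n M : ℕ) (p σ : ℝ) (i : ℕ) : ℕ → ℝ
  | 0 => 1
  | t + 1 => chainError p σ (fun k => blockSize n M t k) (fun k => taskDist (blockTask t k) i)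
      (sequentialError n M p σ i t) (t + 1)

/-- Expected model error of concurrent rehearsal over task `i` after `t` tasks. -/
noncomputable def concurrentError (n M : ℕ) (p σ : ℝ) (i : ℕ) : ℕ → ℝ
  | 0 => 1
  | t + 1 => jointError p σ (fun k => blockSize n M t k) (fun k => taskDist (blockTask t k) i)
      (concurrentError n M p σ i t) (t + 1)

lemma blockTask_injOn (t : ℕ) : Set.InjOn (blockTask t) (Finset.range (t + 1)) := by
  intro k hk l hl h
  have hk' : k < t + 1 := by simpa using hk
  have hl' : l < t + 1 := by simpa using hl
  unfold blockTask at h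
  split_ifs at h <;> omega

/-- Different blocks of a stage belong to different tasks, at squared distance `2`, so half the
double sum counts the ordered pairs of samples from different blocks. -/
lemma sum_sum_taskDist (r : ℕ → ℝ) (t : ℕ) :
    (∑ k ∈ Finset.range (t + 1), r k * ∑ l ∈ Finset.range (t + 1), r l *
      taskDist (blockTask t l) (blockTask t k)) / 2 =
    (∑ k ∈ Finset.range (t + 1), r k) ^ 2 - ∑ k ∈ Finset.range (t + 1), r k ^ 2 := by
  have h : ∀ k ∈ Finset.range (t + 1), ∑ l ∈ Finset.range (t + 1), r l *
      taskDist (blockTask t l) (blockTask t k) =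
      2 * (∑ l ∈ Finset.range (t + 1), r l) - 2 * r k := by
    intro k hk
    have h2 : ∀ l ∈ Finset.range (t + 1), r l * taskDist (blockTask t l) (blockTask t k) =
        2 * r l - if l = k then 2 * r l else 0 := by
      intro l hl
      rw [taskDist]
      by_cases hlk : l = k
      · simp [hlk]
      · rw [if_neg fun e => hlk (blockTask_injOn t hl hk e), if_neg hlk]
        ring
    rw [Finset.sum_congr rfl h2, Finset.sum_sub_distrib, ← Finset.mul_sum, Finset.sum_ite_eq',
      if_pos hk]
  have h3 : ∀ k ∈ Finset.range (t + 1), r k * ∑ l ∈ Finset.range (t + 1), r l *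
      taskDist (blockTask t l) (blockTask t k) =
      r k * (2 * ∑ l ∈ Finset.range (t + 1), r l) - 2 * r k ^ 2 := fun k hk => by
    rw [h k hk]; ring
  rw [Finset.sum_congr rfl h3, Finset.sum_sub_distrib, ← Finset.sum_mul, ← Finset.mul_sum]
  ring

/-- `w` has a version that is a function of the samples in `B`, with expected model errors `a`. -/
def HasErrors {Ω : Type*} [MeasurableSpace Ω] (P : Measure Ω) {T n M p : ℕ}
    (X : Sample T n M → Ω → Vec p) (z : Sample T n M → Ω → ℝ) (wstar : Fin T → Vec p)
    (w : Ω → Vec p) (B : Set (Sample T n M)) (a : Fin T → ℝ) : Prop :=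
  ∃ w' : Ω → Vec p, Measurable[sigmaOf X z B] w' ∧ w' =ᵐ[P] w ∧
    ∀ i, Integrable (fun ω => ‖w' ω - wstar i‖ ^ 2) P ∧ ∫ ω, ‖w' ω - wstar i‖ ^ 2 ∂P = a i

section Data

variable {Ω : Type*} [MeasurableSpace Ω] {P : Measure Ω} [IsProbabilityMeasure P]
  {T n M p : ℕ} {σ : ℝ≥0} {X : Sample T n M → Ω → Vec p} {z : Sample T n M → Ω → ℝ}
  {wstar : Fin T → Vec p}

/-- `train` is defined by choice and carries no measurability of its own. It agrees almost surely
with the measurable sample-by-sample fit, which is enough for later independence. -/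
lemma HasErrors.train (hD : IsGaussianData P σ X z) (hX : ∀ s, Measurable (X s))
    (hz : ∀ s, Measurable (z s)) {w : Ω → Vec p} {B B' : Set (Sample T n M)} {a : Fin T → ℝ}
    (hw : HasErrors P X z wstar w B a) (A : Finset (Sample T n M)) (hBA : Disjoint B A)
    (hB' : B ∪ A ⊆ B') (hA : A.card + 2 ≤ p) :
    HasErrors P X z wstar (fun ω => Rehearsal.train (fun s => X s ω)
      (label wstar (fun s => X s ω) (fun s => z s ω)) A (w ω)) B' fun i =>
        (1 - A.card / p) * a i +
          (truthDist wstar A i + truthSpread wstar A / ((p : ℝ) - A.card - 1)) / p +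
          A.card * (σ : ℝ) ^ 2 / ((p : ℝ) - A.card - 1) := by
  obtain ⟨w', hm, hae, hint⟩ := hw
  obtain ⟨W, R, hW, -, hfit, h1, -⟩ := hD.exists_fit hX hz hm (fun i => (hint i).1) A hBA hA
  refine ⟨W, hW.mono (sigmaOf_mono hB') le_rfl, ?_, fun i => ⟨(h1 i).1, ?_⟩⟩
  · filter_upwards [hae, hfit] with ω h2 h3
    rw [← h2, h3.train_eq]
  · rw [(h1 i).2, (hint i).2]

lemma HasErrors.zero (ho : Orthonormal ℝ wstar) (B : Set (Sample T n M)) :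
    HasErrors P X z wstar (fun _ => 0) B fun _ => 1 :=
  ⟨fun _ => 0, measurable_const, Filter.EventuallyEq.rfl, fun i =>
    ⟨integrable_const _, by simp [ho.1 i]⟩⟩

lemma hasErrors_concurrentParam (hD : IsGaussianData P σ X z) (hX : ∀ s, Measurable (X s))
    (hz : ∀ s, Measurable (z s)) (ho : Orthonormal ℝ wstar)
    (hp : ∀ t < T, (∑ k ∈ Finset.range (t + 1), blockSize n M t k) + 2 ≤ p) (t : ℕ) (ht : t ≤ T) :
    HasErrors P X z wstar (concurrentParam wstar X z t) {s | stage s < t}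
      fun i => concurrentError n M p σ i t := by
  induction t with
  | zero => exact HasErrors.zero ho _
  | succ t ih =>
    obtain ⟨A, hA, hsum⟩ := exists_stage T n M (t := t) (by omega)
    have hcard : A.card = ∑ k ∈ Finset.range (t + 1), blockSize n M t k := by
      have := hsum fun _ => 1
      simp only [Finset.sum_const, nsmul_eq_mul, mul_one] at this
      exact_mod_cast this
    have h := HasErrors.train hD hX hz (ih (by omega)) A (B' := {s | stage s < t + 1})
      (by rw [hA]; exact Set.disjoint_left.2 fun s h1 h2 => (Nat.ne_of_lt h1) h2)
      (by
        rw [hA]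
        rintro s (h1 | h1)
        · exact Nat.lt_succ_of_lt h1
        · exact Nat.lt_succ_of_le (le_of_eq h1))
      (by rw [hcard]; exact hp t (by omega))
    have hd : ∀ i : Fin T, truthDist wstar A i = ∑ k ∈ Finset.range (t + 1),
        (blockSize n M t k : ℝ) * taskDist (blockTask t k) i := by
      intro i
      rw [← hsum fun h => taskDist h i]
      exact Finset.sum_congr rfl fun s _ => norm_sub_sq_eq_taskDist ho _ _
    have hs : truthSpread wstar A = (∑ k ∈ Finset.range (t + 1), (blockSize n M t k : ℝ)) ^ 2 -
        ∑ k ∈ Finset.range (t + 1), (blockSize n M t k : ℝ) ^ 2 := by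
      rw [← sum_sum_taskDist (fun k => (blockSize n M t k : ℝ)), truthSpread]
      simp_rw [hd]
      rw [hsum fun h => ∑ k ∈ Finset.range (t + 1),
        (blockSize n M t k : ℝ) * taskDist (blockTask t k) h]
    simp_rw [hd, hs, hcard, hA, ← concurrentData_eq] at h
    push_cast at h
    exact h

/-- The state before a block depends only on samples that precede it lexicographically in stage and
position. All samples of a block share one ground truth, so the pair term vanishes. -/
lemma hasErrors_block (hD : IsGaussianData P σ X z) (hX : ∀ s, Measurable (X s))
    (hz : ∀ s, Measurable (z s)) (ho : Orthonormal ℝ wstar) {t k : ℕ} (ht : t < T)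
    (hk : k < t + 1) (hp : blockSize n M t k + 2 ≤ p) {w : Ω → Vec p} {a : Fin T → ℝ}
    (hw : HasErrors P X z wstar w {s | stage s < t ∨ stage s = t ∧ position s < k} a) :
    HasErrors P X z wstar (fun ω => Rehearsal.train (fun s => X s ω)
      (label wstar (fun s => X s ω) (fun s => z s ω)) {s | stage s = t ∧ position s = k} (w ω))
      {s | stage s < t ∨ stage s = t ∧ position s < k + 1} fun i =>
        (1 - blockSize n M t k / p) * a i + blockSize n M t k * taskDist (blockTask t k) i / p +
          blockSize n M t k * (σ : ℝ) ^ 2 / ((p : ℝ) - blockSize n M t k - 1) := by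
  obtain ⟨A, hA, hcard, htask⟩ := exists_block T n M ht hk
  have h := HasErrors.train hD hX hz hw A
    (B' := {s | stage s < t ∨ stage s = t ∧ position s < k + 1})
    (by
      rw [hA]
      refine Set.disjoint_left.2 fun s h1 h2 => ?_
      simp only [Set.mem_ofPred_eq] at h1 h2
      omega)
    (by
      rw [hA]
      intro s hs
      simp only [Set.mem_union, Set.mem_ofPred_eq] at hs ⊢
      omega)
    (by rw [hcard]; exact hp)
  have hd : ∀ i : Fin T, truthDist wstar A i =
      (blockSize n M t k : ℝ) * taskDist (blockTask t k) i := by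
    intro i
    rw [truthDist, Finset.sum_congr rfl fun s hs => by
      rw [norm_sub_sq_eq_taskDist ho, htask s hs], Finset.sum_const, hcard, nsmul_eq_mul]
  have hs : truthSpread wstar A = 0 := by
    rw [truthSpread, Finset.sum_eq_zero fun s hs => ?_, zero_div]
    rw [hd, htask s hs]
    simp [taskDist]
  simp_rw [hd, hs, hcard, hA, zero_div, add_zero] at h
  exact h

lemma hasErrors_revisit (hD : IsGaussianData P σ X z) (hX : ∀ s, Measurable (X s))
    (hz : ∀ s, Measurable (z s)) (ho : Orthonormal ℝ wstar) {t : ℕ} (ht : t < T)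
    (hp : ∀ k < t + 1, blockSize n M t k + 2 ≤ p) {w : Ω → Vec p} {a : Fin T → ℝ}
    (hw : HasErrors P X z wstar w {s | stage s < t} a) (k : ℕ) (hk : k < t + 1) :
    HasErrors P X z wstar (fun ω => revisit (fun s => X s ω)
      (label wstar (fun s => X s ω) (fun s => z s ω)) t (w ω) k)
      {s | stage s < t ∨ stage s = t ∧ position s < k + 1} fun i =>
        chainError p σ (fun k => blockSize n M t k) (fun k => taskDist (blockTask t k) i)
          (a i) (k + 1) := by
  induction k with
  | zero =>
    have h := hasErrors_block hD hX hz ho ht hk (hp 0 hk) (w := w) (a := a) (by simpa using hw)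
    rw [← currentData_eq] at h
    exact h
  | succ k ih =>
    have h := hasErrors_block hD hX hz ho ht hk (hp _ hk) (ih (by omega))
    rw [← memoryData_eq] at h
    exact h

lemma hasErrors_sequentialParam (hD : IsGaussianData P σ X z) (hX : ∀ s, Measurable (X s))
    (hz : ∀ s, Measurable (z s)) (ho : Orthonormal ℝ wstar)
    (hp : ∀ t < T, (∑ k ∈ Finset.range (t + 1), blockSize n M t k) + 2 ≤ p) (t : ℕ) (ht : t ≤ T) :
    HasErrors P X z wstar (sequentialParam wstar X z t) {s | stage s < t}
      fun i => sequentialError n M p σ i t := by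
  induction t with
  | zero => exact HasErrors.zero ho _
  | succ t ih =>
    have h := hasErrors_revisit hD hX hz ho (by omega) (fun k hk =>
      (Nat.add_le_add_right (Finset.single_le_sum (f := fun k => blockSize n M t k)
        (fun _ _ => Nat.zero_le _) (Finset.mem_range.2 hk)) 2).trans (hp t (by omega)))
      (ih (by omega)) t (by omega)
    obtain ⟨w', h1, h2⟩ := h
    refine ⟨w', h1.mono (sigmaOf_mono fun s hs => ?_) le_rfl, h2⟩
    simp only [Set.mem_ofPred_eq] at hs ⊢
    omega

end Data

/-- The expected model errors of both methods. -/
lemma IsGaussianData.integral_modelError {Ω : Type*} [MeasurableSpace Ω] {P : Measure Ω}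
    [IsProbabilityMeasure P] {T n M p : ℕ} {σ : ℝ≥0} {X : Sample T n M → Ω → Vec p}
    {z : Sample T n M → Ω → ℝ} {wstar : Fin T → Vec p} (hD : IsGaussianData P σ X z)
    (ho : Orthonormal ℝ wstar)
    (hp : ∀ t < T, (∑ k ∈ Finset.range (t + 1), blockSize n M t k) + 2 ≤ p) (i : Fin T)
    (t : ℕ) (ht : t ≤ T) :
    (Integrable (fun ω => modelError wstar i (concurrentParam wstar X z t ω)) P ∧
      ∫ ω, modelError wstar i (concurrentParam wstar X z t ω) ∂P = concurrentError n M p σ i t) ∧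
    (Integrable (fun ω => modelError wstar i (sequentialParam wstar X z t ω)) P ∧
      ∫ ω, modelError wstar i (sequentialParam wstar X z t ω) ∂P = sequentialError n M p σ i t) := by
  -- The laws provide only almost everywhere measurability, so the data are replaced by measurable
  -- versions; laws and independence carry over.
  have hXc : ∀ s, ∃ X' : Ω → Vec p, Measurable X' ∧ X s =ᵐ[P] X' := fun s =>
    (show AEMeasurable (X s) P from (WithLp.measurable_toLp 2 (Fin p → ℝ)).comp_aemeasurable
      (aemeasurable_pi_iff.2 fun k => (hD.law_feature s k).aemeasurable))
  have hzc : ∀ s, ∃ z' : Ω → ℝ, Measurable z' ∧ z s =ᵐ[P] z' := fun s =>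
    (hD.law_noise s).aemeasurable
  choose X' hX' hXX using hXc
  choose z' hz' hzz using hzc
  have hD' : IsGaussianData P σ X' z' := by
    have hc : ∀ s k, (fun ω => X s ω k) =ᵐ[P] fun ω => X' s ω k := fun s k => by
      filter_upwards [hXX s] with ω h
      rw [h]
    refine ⟨fun s k => (hD.law_feature s k).congr (hc s k).symm,
      fun s => (hD.law_noise s).congr (hzz s).symm, hD.indep.congr fun q => ?_⟩
    rcases q with q | q
    · exact hc q.1 q.2
    · exact hzz q
  have hdata : ∀ᵐ ω ∂P, (fun s => X s ω) = (fun s => X' s ω) ∧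
      (fun s => z s ω) = fun s => z' s ω := by
    filter_upwards [ae_all_iff.2 hXX, ae_all_iff.2 hzz] with ω h1 h2
    exact ⟨funext h1, funext h2⟩
  obtain ⟨w1, -, hw1, h1⟩ := hasErrors_concurrentParam hD' hX' hz' ho hp t ht
  obtain ⟨w2, -, hw2, h2⟩ := hasErrors_sequentialParam hD' hX' hz' ho hp t ht
  have e1 : (fun ω => ‖w1 ω - wstar i‖ ^ 2) =ᵐ[P]
      fun ω => modelError wstar i (concurrentParam wstar X z t ω) := by
    filter_upwards [hw1, hdata] with ω h hd
    rw [modelError, h, concurrentParam, concurrentParam, hd.1, hd.2]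
  have e2 : (fun ω => ‖w2 ω - wstar i‖ ^ 2) =ᵐ[P]
      fun ω => modelError wstar i (sequentialParam wstar X z t ω) := by
    filter_upwards [hw2, hdata] with ω h hd
    rw [modelError, h, sequentialParam, sequentialParam, hd.1, hd.2]
  exact ⟨⟨(h1 i).1.congr e1, by rw [← integral_congr_ae e1, (h1 i).2]⟩,
    (h2 i).1.congr e2, by rw [← integral_congr_ae e2, (h2 i).2]⟩

end Rehearsal

/-! ### Comparison of the two recursions. -/

namespace Rehearsal

section Chain

variable {p σ L : ℝ} {r τ : ℕ → ℝ} {K : ℕ}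

lemma chainError_nonneg (hr : ∀ k, 0 ≤ r k) (hτ : ∀ k, 0 ≤ τ k) (hL : 0 ≤ L)
    (hp : ∀ k < K, r k + 1 < p) : ∀ k ≤ K, 0 ≤ chainError p σ r τ L k
  | 0, _ => hL
  | k + 1, hk => by
    have h := chainError_nonneg hr hτ hL hp k (by omega)
    have h1 := hp k (by omega)
    have h2 := hr k
    have h3 := hτ k
    have hp0 : 0 < p := by linarith
    have h4 : 0 ≤ 1 - r k / p := by
      rw [sub_nonneg, div_le_one hp0]; linarith
    have h5 : 0 < p - r k - 1 := by linarith
    rw [chainError]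
    positivity

/-- The shrinkage only helps; the truth term contributes at most `2`, and `p - r k - 1 ≥ p / 2`
turns the noise into at most `2 * σ ^ 2`, both times `r k / p`. -/
lemma chainError_succ_le (hr : ∀ k, 0 ≤ r k) (hτ : ∀ k, τ k ≤ 2) {k : ℕ}
    (h0 : 0 ≤ chainError p σ r τ L k) (hp : 4 * (r k + 1) ≤ p) :
    chainError p σ r τ L (k + 1) ≤ chainError p σ r τ L k + r k / p * (2 + 2 * σ ^ 2) := by
  have h2 := hr k
  have hp0 : 0 < p := by linarith
  have h1 : r k * σ ^ 2 / (p - r k - 1) ≤ r k * σ ^ 2 / (p / 2) := by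
    gcongr
    linarith
  have h3 : r k * τ k / p ≤ r k * 2 / p := by
    gcongr
    exact hτ k
  have h4 : 0 ≤ r k / p * chainError p σ r τ L k := by positivity
  have h5 : r k * σ ^ 2 / (p / 2) = r k / p * (2 * σ ^ 2) := by field_simp
  have h6 : r k * 2 / p = r k / p * 2 := by ring
  rw [chainError]
  linarith

lemma chainError_le (hr : ∀ k, 0 ≤ r k) (hτ0 : ∀ k, 0 ≤ τ k) (hτ : ∀ k, τ k ≤ 2) (hL : 0 ≤ L)
    (hp : ∀ k < K, 4 * (r k + 1) ≤ p) : ∀ k ≤ K,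
    chainError p σ r τ L k ≤ L + (∑ j ∈ Finset.range k, r j) / p * (2 + 2 * σ ^ 2)
  | 0, _ => by simp [chainError]
  | k + 1, hk => by
    have h := chainError_le hr hτ0 hτ hL hp k (by omega)
    have h0 := chainError_nonneg (p := p) (σ := σ) (K := K) hr hτ0 hL
      (fun k hk => by linarith [hp k hk, hr k]) k (by omega)
    have h1 := chainError_succ_le hr hτ h0 (hp k (by omega))
    rw [Finset.sum_range_succ, add_div, add_mul]
    linarith

/-- Truth and noise terms are dropped, and each shrinkage costs at most `r k / p * U`. -/
lemma le_chainError (hr : ∀ k, 0 ≤ r k) (hτ0 : ∀ k, 0 ≤ τ k) (hp : ∀ k < K, r k + 1 < p)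
    {U : ℝ} (hU : ∀ k ≤ K, chainError p σ r τ L k ≤ U) : ∀ k ≤ K,
    L - (∑ j ∈ Finset.range k, r j) / p * U ≤ chainError p σ r τ L k
  | 0, _ => by simp [chainError]
  | k + 1, hk => by
    have h := le_chainError hr hτ0 hp hU k (by omega)
    have h1 := hp k (by omega)
    have h2 := hr k
    have h3 := hτ0 k
    have hp0 : 0 < p := by linarith
    have h5 : 0 < p - r k - 1 := by linarith
    have h6 : r k / p * chainError p σ r τ L k ≤ r k / p * U := by
      gcongr
      exact hU k (by omega)
    have h7 : 0 ≤ r k * τ k / p := by positivity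
    have h8 : 0 ≤ r k * σ ^ 2 / (p - r k - 1) := by positivity
    rw [chainError, Finset.sum_range_succ, add_div, add_mul]
    linarith

lemma chainError_eq_sum (K : ℕ) : chainError p σ r τ L K = L + ∑ k ∈ Finset.range K,
    (r k * (τ k - chainError p σ r τ L k) / p + r k * σ ^ 2 / (p - r k - 1)) := by
  induction K with
  | zero => simp [chainError]
  | succ K ih =>
    rw [Finset.sum_range_succ, ← add_assoc, ← ih, chainError]
    ring

/-- Links the pair count to the partial sums that bound the drift of the error between successive
blocks. -/
lemma sum_sq_sub_sum_sq (r : ℕ → ℝ) (K : ℕ) :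
    (∑ k ∈ Finset.range K, r k) ^ 2 - ∑ k ∈ Finset.range K, r k ^ 2 =
      2 * ∑ k ∈ Finset.range K, r k * ∑ j ∈ Finset.range k, r j := by
  induction K with
  | zero => simp
  | succ K ih =>
    simp only [Finset.sum_range_succ _ K]
    linear_combination ih

lemma sum_mul_sum_sub (r : ℕ → ℝ) (K : ℕ) :
    ∑ k ∈ Finset.range K, r k * ((∑ j ∈ Finset.range K, r j) - r k) =
      (∑ k ∈ Finset.range K, r k) ^ 2 - ∑ k ∈ Finset.range K, r k ^ 2 := by
  simp_rw [mul_sub, Finset.sum_sub_distrib, ← Finset.sum_mul, sq]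

/-- One task: the gap between joint and successive training from the same point is of the order of
the number of pairs of samples of different datasets divided by `p ^ 2`. -/
lemma jointError_sub_chainError_bounds (hr : ∀ k, 0 ≤ r k) (hτ0 : ∀ k, 0 ≤ τ k)
    (hτ : ∀ k, τ k ≤ 2) (hL : 0 ≤ L) (hp : 4 * ((∑ k ∈ Finset.range K, r k) + 1) ≤ p)
    (hU : L + (∑ k ∈ Finset.range K, r k) / p * (2 + 2 * σ ^ 2) ≤ 3 / 2 * (1 + σ ^ 2)) :
    ((∑ k ∈ Finset.range K, r k) ^ 2 - ∑ k ∈ Finset.range K, r k ^ 2) * (1 + σ ^ 2) /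
        (4 * p ^ 2) ≤ jointError p σ r τ L K - chainError p σ r τ L K ∧
      jointError p σ r τ L K - chainError p σ r τ L K ≤
        5 * (((∑ k ∈ Finset.range K, r k) ^ 2 - ∑ k ∈ Finset.range K, r k ^ 2) * (1 + σ ^ 2)) /
          p ^ 2 := by
  set N := ∑ k ∈ Finset.range K, r k with hN
  have hN0 : 0 ≤ N := Finset.sum_nonneg fun k _ => hr k
  have hp0 : 0 < p := by linarith
  have hrN : ∀ k ∈ Finset.range K, r k ≤ N := fun k hk =>
    Finset.single_le_sum (f := r) (fun k _ => hr k) hk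
  have hp4 : ∀ k < K, 4 * (r k + 1) ≤ p := fun k hk => by
    linarith [hrN k (Finset.mem_range.2 hk)]
  have hp1 : ∀ k < K, r k + 1 < p := fun k hk => by linarith [hp4 k hk, hr k]
  have hup := chainError_le (σ := σ) hr hτ0 hτ hL hp4
  have hpart : ∀ k ≤ K, ∑ j ∈ Finset.range k, r j ≤ N := fun k hk =>
    Finset.sum_le_sum_of_subset_of_nonneg (Finset.range_mono hk) fun j _ _ => hr j
  have hU' : ∀ k ≤ K, chainError p σ r τ L k ≤ 3 / 2 * (1 + σ ^ 2) := fun k hk => by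
    refine (hup k hk).trans (le_trans ?_ hU)
    have := hpart k hk
    gcongr
  have hlow := le_chainError hr hτ0 hp1 hU'
  set J := N ^ 2 - ∑ k ∈ Finset.range K, r k ^ 2 with hJ
  have hE : ∑ k ∈ Finset.range K, r k * ∑ j ∈ Finset.range k, r j = J / 2 := by
    rw [hJ, hN, sum_sq_sub_sum_sq]; ring
  have hJ' : ∑ k ∈ Finset.range K, r k * (N - r k) = J := by
    rw [hN, sum_mul_sum_sub]
  have hJ0 : 0 ≤ J := by
    rw [← hJ']
    exact Finset.sum_nonneg fun k hk => mul_nonneg (hr k) (by linarith [hrN k hk])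
  -- The truth distances cancel. What remains is the pair term, the excess noise of joint training,
  -- and the drift of the successive errors away from `L`; only the drift can be negative.
  have hgap : jointError p σ r τ L K - chainError p σ r τ L K = J / (p - N - 1) / p +
      ∑ k ∈ Finset.range K, σ ^ 2 * (r k * (N - r k) / ((p - N - 1) * (p - r k - 1))) +
      ∑ k ∈ Finset.range K, r k * (chainError p σ r τ L k - L) / p := by
    have h1 : ∑ k ∈ Finset.range K, (r k * (τ k - chainError p σ r τ L k) / p +
        r k * σ ^ 2 / (p - r k - 1)) = (∑ k ∈ Finset.range K, r k * τ k) / p - N / p * L +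
        N * σ ^ 2 / (p - N - 1) -
        (∑ k ∈ Finset.range K, σ ^ 2 * (r k * (N - r k) / ((p - N - 1) * (p - r k - 1))) +
        ∑ k ∈ Finset.range K, r k * (chainError p σ r τ L k - L) / p) := by
      simp only [hN, Finset.sum_div, Finset.sum_mul]
      rw [← hN, ← Finset.sum_sub_distrib, ← Finset.sum_add_distrib, ← Finset.sum_add_distrib,
        ← Finset.sum_sub_distrib]
      refine Finset.sum_congr rfl fun k hk => ?_
      have h2 : p - N - 1 ≠ 0 := by linarith
      have h3 : p - r k - 1 ≠ 0 := by linarith [hp1 k (Finset.mem_range.1 hk)]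
      field_simp
      ring
    rw [chainError_eq_sum, h1, jointError, ← hN, ← hJ]
    ring
  have hden : 0 < p - N - 1 := by linarith
  have b1 : J / p ^ 2 ≤ J / (p - N - 1) / p := by
    rw [div_div]
    gcongr
    nlinarith
  have b1' : J / (p - N - 1) / p ≤ 2 * J / p ^ 2 := by
    rw [div_div, div_le_div_iff₀ (by positivity) (by positivity)]
    have h : 0 ≤ J * p * (p - 2 * N - 2) := mul_nonneg (by positivity) (by linarith)
    nlinarith
  have b2 : σ ^ 2 * J / p ^ 2 ≤
      ∑ k ∈ Finset.range K, σ ^ 2 * (r k * (N - r k) / ((p - N - 1) * (p - r k - 1))) := by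
    rw [← hJ', Finset.mul_sum, Finset.sum_div]
    refine Finset.sum_le_sum fun k hk => ?_
    have h1 := hrN k hk
    have h2 := hp1 k (Finset.mem_range.1 hk)
    have h3 : 0 ≤ r k * (N - r k) := mul_nonneg (hr k) (by linarith)
    rw [mul_div_assoc]
    gcongr
    · exact mul_pos hden (by linarith)
    · rw [sq]
      have := hr k
      gcongr <;> linarith
  have b2' : ∑ k ∈ Finset.range K, σ ^ 2 * (r k * (N - r k) / ((p - N - 1) * (p - r k - 1))) ≤
      4 * (σ ^ 2 * J) / p ^ 2 := by
    rw [← hJ', Finset.mul_sum, Finset.mul_sum, Finset.sum_div]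
    refine Finset.sum_le_sum fun k hk => ?_
    have h1 := hrN k hk
    have h2 := hp1 k (Finset.mem_range.1 hk)
    have h3 : 0 ≤ r k * (N - r k) := mul_nonneg (hr k) (by linarith)
    have h4 : r k * (N - r k) / ((p - N - 1) * (p - r k - 1)) ≤
        r k * (N - r k) / (p / 2 * (p / 2)) := by
      gcongr <;> linarith
    calc _ ≤ σ ^ 2 * (r k * (N - r k) / (p / 2 * (p / 2))) := by gcongr
      _ = _ := by field_simp; ring
  have b3 : -(J / 2 / p ^ 2 * (3 / 2 * (1 + σ ^ 2))) ≤
      ∑ k ∈ Finset.range K, r k * (chainError p σ r τ L k - L) / p := by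
    rw [← hE, Finset.sum_div, Finset.sum_mul, ← Finset.sum_neg_distrib]
    refine Finset.sum_le_sum fun k hk => ?_
    have h1 := hlow k (Finset.mem_range.1 hk).le
    have h2 : r k * -((∑ j ∈ Finset.range k, r j) / p * (3 / 2 * (1 + σ ^ 2))) / p ≤
        r k * (chainError p σ r τ L k - L) / p := by
      have := hr k
      gcongr
      linarith
    refine le_trans (le_of_eq ?_) h2
    field_simp
  have b3' : ∑ k ∈ Finset.range K, r k * (chainError p σ r τ L k - L) / p ≤
      J / 2 / p ^ 2 * (2 + 2 * σ ^ 2) := by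
    rw [← hE, Finset.sum_div, Finset.sum_mul]
    refine Finset.sum_le_sum fun k hk => ?_
    have h1 := hup k (Finset.mem_range.1 hk).le
    have h2 : r k * (chainError p σ r τ L k - L) / p ≤
        r k * ((∑ j ∈ Finset.range k, r j) / p * (2 + 2 * σ ^ 2)) / p := by
      have := hr k
      gcongr
      linarith
    refine h2.trans (le_of_eq ?_)
    field_simp
  rw [hgap]
  have hq : 0 ≤ J / p ^ 2 := by positivity
  have e1 : σ ^ 2 * J / p ^ 2 = σ ^ 2 * (J / p ^ 2) := by ring
  have e2 : J / 2 / p ^ 2 * (3 / 2 * (1 + σ ^ 2)) = 3 / 4 * (1 + σ ^ 2) * (J / p ^ 2) := by ring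
  have e3 : 2 * J / p ^ 2 = 2 * (J / p ^ 2) := by ring
  have e4 : 4 * (σ ^ 2 * J) / p ^ 2 = 4 * σ ^ 2 * (J / p ^ 2) := by ring
  have e5 : J / 2 / p ^ 2 * (2 + 2 * σ ^ 2) = (1 + σ ^ 2) * (J / p ^ 2) := by ring
  -- In units of `J / p ^ 2`: the lower bound is `1 + σ ^ 2` minus `3 / 4 * (1 + σ ^ 2)`, the upper
  -- bound `2 + 4 * σ ^ 2` plus `1 + σ ^ 2`.
  constructor
  · have e6 : J * (1 + σ ^ 2) / (4 * p ^ 2) = 1 / 4 * (1 + σ ^ 2) * (J / p ^ 2) := by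
      field_simp
    rw [e6]
    linarith
  · have e6 : 5 * (J * (1 + σ ^ 2)) / p ^ 2 = 5 * (1 + σ ^ 2) * (J / p ^ 2) := by ring
    rw [e6]
    linarith

/-- The joint error is affine in its starting value, so stages entered with different errors reduce
to a common start plus a shrunken old gap. -/
lemma jointError_sub (L L' : ℝ) : jointError p σ r τ L K - jointError p σ r τ L' K =
    (1 - (∑ k ∈ Finset.range K, r k) / p) * (L - L') := by
  rw [jointError, jointError]
  ring

end Chain

lemma taskDist_nonneg (h i : ℕ) : 0 ≤ taskDist h i := by
  rw [taskDist]; split_ifs <;> norm_num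

lemma taskDist_le_two (h i : ℕ) : taskDist h i ≤ 2 := by
  rw [taskDist]; split_ifs <;> norm_num

/-- Total number of samples used while training on task `t`. -/
noncomputable def stageSize (n M t : ℕ) : ℝ :=
  ∑ k ∈ Finset.range (t + 1), (blockSize n M t k : ℝ)

/-- Twice the number of pairs of samples of different tasks used while training on task `t`. -/
noncomputable def stagePairs (n M t : ℕ) : ℝ :=
  stageSize n M t ^ 2 - ∑ k ∈ Finset.range (t + 1), (blockSize n M t k : ℝ) ^ 2

lemma stageSize_zero (n M : ℕ) : stageSize n M 0 = n := by
  simp [stageSize, blockSize]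

lemma stagePairs_zero (n M : ℕ) : stagePairs n M 0 = 0 := by
  simp [stagePairs, stageSize_zero, blockSize]

lemma sum_blockSize (n M t : ℕ) (hd : t ∣ M) :
    ∑ k ∈ Finset.range (t + 1), blockSize n M t k = n + M := by
  rw [Finset.sum_range_succ']
  simp [blockSize, Nat.mul_div_cancel' hd, add_comm]

lemma stageSize_eq (n M t : ℕ) (hd : t ∣ M) : stageSize n M t = n + M := by
  rw [stageSize]
  exact_mod_cast sum_blockSize n M t hd

lemma stagePairs_eq (n M t : ℕ) (ht : 0 < t) (hd : t ∣ M) :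
    stagePairs n M t = 2 * n * M + M ^ 2 * (1 - 1 / t) := by
  have h : ∑ k ∈ Finset.range (t + 1), (blockSize n M t k : ℝ) ^ 2 = t * (M / t : ℝ) ^ 2 + n ^ 2 := by
    rw [Finset.sum_range_succ']
    simp [blockSize, Nat.cast_div hd (by positivity : (t : ℝ) ≠ 0)]
  have : (t : ℝ) ≠ 0 := by positivity
  rw [stagePairs, h, stageSize_eq n M t hd]
  field_simp
  ring

section Compare

variable {T n M : ℕ} {p σ : ℝ}

/-- Allows all earlier increments of the gap to be bounded by the current one. -/
lemma stagePairs_mono (hdvd : ∀ t, 1 ≤ t → t < T → t ∣ M) {t : ℕ} (ht : t + 1 < T) :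
    stagePairs n M t ≤ stagePairs n M (t + 1) := by
  rw [stagePairs_eq n M (t + 1) (by omega) (hdvd _ (by omega) ht)]
  rcases Nat.eq_zero_or_pos t with rfl | h
  · rw [stagePairs_zero]
    simp
    positivity
  · rw [stagePairs_eq n M t h (hdvd _ h (by omega))]
    have h' : (0 : ℝ) < t := by exact_mod_cast h
    have : (1 : ℝ) / ((t + 1 : ℕ) : ℝ) ≤ 1 / t := by
      push_cast
      gcongr
      linarith
    gcongr

lemma stageSize_le (hdvd : ∀ t, 1 ≤ t → t < T → t ∣ M) {t : ℕ} (ht : t < T) :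
    stageSize n M t ≤ n + M := by
  rcases Nat.eq_zero_or_pos t with rfl | h
  · rw [stageSize_zero]
    have : (0 : ℝ) ≤ M := Nat.cast_nonneg _
    linarith
  · exact (stageSize_eq n M t (hdvd t h ht)).le

lemma stageSize_nonneg (n M t : ℕ) : 0 ≤ stageSize n M t :=
  Finset.sum_nonneg fun _ _ => Nat.cast_nonneg _

lemma stagePairs_nonneg (n M t : ℕ) : 0 ≤ stagePairs n M t := by
  rw [stagePairs, stageSize, sum_sq_sub_sum_sq]
  positivity

lemma sequentialError_nonneg (hdvd : ∀ t, 1 ≤ t → t < T → t ∣ M)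
    (hp : 4 * ((n : ℝ) + M + 1) ≤ p) (i : ℕ) : ∀ t ≤ T, 0 ≤ sequentialError n M p σ i t
  | 0, _ => zero_le_one
  | t + 1, ht => by
    rw [sequentialError]
    refine chainError_nonneg (K := t + 1) (fun _ => Nat.cast_nonneg _)
      (fun _ => taskDist_nonneg _ _) (sequentialError_nonneg hdvd hp i t (by omega))
      (fun k hk => ?_) _ le_rfl
    have h1 := Finset.single_le_sum (f := fun k => (blockSize n M t k : ℝ))
      (fun _ _ => Nat.cast_nonneg _) (Finset.mem_range.2 hk)
    have h2 : stageSize n M t ≤ n + M := stageSize_le hdvd ht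
    have h3 : (0 : ℝ) ≤ n + M := by positivity
    simp only [stageSize] at h2
    linarith

lemma sequentialError_le (hdvd : ∀ t, 1 ≤ t → t < T → t ∣ M)
    (hp : 4 * ((n : ℝ) + M + 1) ≤ p) (i : ℕ) : ∀ t ≤ T,
    sequentialError n M p σ i t ≤ 1 + t * (((n : ℝ) + M) / p * (2 + 2 * σ ^ 2))
  | 0, _ => by simp [sequentialError]
  | t + 1, ht => by
    have h3 : (0 : ℝ) ≤ n + M := by positivity
    have h2 : stageSize n M t ≤ n + M := stageSize_le hdvd ht
    have hp0 : 0 < p := by linarith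
    have h := chainError_le (p := p) (σ := σ) (K := t + 1)
      (r := fun k => (blockSize n M t k : ℝ)) (τ := fun k => taskDist (blockTask t k) i)
      (fun _ => Nat.cast_nonneg _)
      (fun _ => taskDist_nonneg _ _) (fun _ => taskDist_le_two _ _)
      (sequentialError_nonneg (σ := σ) hdvd hp i t (by omega)) (fun k hk => by
        have h1 := Finset.single_le_sum (f := fun k => (blockSize n M t k : ℝ))
          (fun _ _ => Nat.cast_nonneg _) (Finset.mem_range.2 hk)
        simp only [stageSize] at h2
        linarith) (t + 1) le_rfl
    have ih := sequentialError_le hdvd hp i t (by omega)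
    have h4 : stageSize n M t / p * (2 + 2 * σ ^ 2) ≤ ((n : ℝ) + M) / p * (2 + 2 * σ ^ 2) := by
      gcongr
    rw [sequentialError]
    rw [← stageSize] at h
    push_cast
    linarith

/-- The gap between the expected model errors of the two methods. -/
lemma errorGap_bounds (hdvd : ∀ t, 1 ≤ t → t < T → t ∣ M) (hM : 1 ≤ M)
    (hp : 100 * (T * ((n : ℝ) + M)) ≤ p) (i : ℕ) {t : ℕ} (ht : t < T) :
    stagePairs n M t * (1 + σ ^ 2) / (4 * p ^ 2) ≤
        concurrentError n M p σ i (t + 1) - sequentialError n M p σ i (t + 1) -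
        (1 - stageSize n M t / p) *
          (concurrentError n M p σ i t - sequentialError n M p σ i t) ∧
      concurrentError n M p σ i (t + 1) - sequentialError n M p σ i (t + 1) -
        (1 - stageSize n M t / p) *
          (concurrentError n M p σ i t - sequentialError n M p σ i t) ≤
        5 * (stagePairs n M t * (1 + σ ^ 2)) / p ^ 2 := by
  have hM' : (1 : ℝ) ≤ M := by exact_mod_cast hM
  have hn0 : (0 : ℝ) ≤ n := Nat.cast_nonneg _
  have hT1 : (1 : ℝ) ≤ T := by exact_mod_cast (by omega : 1 ≤ T)
  have hTN : (n : ℝ) + M ≤ T * (n + M) := le_mul_of_one_le_left (by positivity) hT1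
  have hp4 : 4 * ((n : ℝ) + M + 1) ≤ p := by linarith
  have hp0 : 0 < p := by linarith
  have hsz : stageSize n M t ≤ n + M := stageSize_le hdvd ht
  have hle := sequentialError_le (σ := σ) hdvd hp4 i t ht.le
  -- Keeps the error, starting from `1`, below `3 / 2 * (1 + σ ^ 2)` through this stage, as the
  -- one-stage bounds require.
  have hsmall : ((n : ℝ) + M) / p * (2 + 2 * σ ^ 2) * (t + 1) ≤ 1 / 2 * (1 + σ ^ 2) := by
    have h1 : ((n : ℝ) + M) / p * (t + 1) ≤ 1 / 100 := by
      have h2 : (t : ℝ) + 1 ≤ T := by exact_mod_cast ht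
      have h3 : ((n : ℝ) + M) * (t + 1) ≤ T * (n + M) := by
        rw [mul_comm (T : ℝ)]; gcongr
      rw [div_mul_eq_mul_div, div_le_iff₀ hp0]
      linarith
    nlinarith [sq_nonneg σ]
  have hsz' : stageSize n M t / p * (2 + 2 * σ ^ 2) ≤ ((n : ℝ) + M) / p * (2 + 2 * σ ^ 2) := by
    gcongr
  have h := jointError_sub_chainError_bounds (p := p) (σ := σ) (K := t + 1)
    (L := sequentialError n M p σ i t)
    (r := fun k => (blockSize n M t k : ℝ)) (τ := fun k => taskDist (blockTask t k) i)
    (fun _ => Nat.cast_nonneg _) (fun _ => taskDist_nonneg _ _) (fun _ => taskDist_le_two _ _)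
    (sequentialError_nonneg (σ := σ) hdvd hp4 i t ht.le)
    (by rw [← stageSize]; linarith)
    (by rw [← stageSize]; nlinarith [sq_nonneg σ])
  rw [← stageSize, ← stagePairs] at h
  have hd := jointError_sub (p := p) (σ := σ) (K := t + 1)
    (r := fun k => (blockSize n M t k : ℝ)) (τ := fun k => taskDist (blockTask t k) i)
    (concurrentError n M p σ i t) (sequentialError n M p σ i t)
  rw [← stageSize] at hd
  rw [concurrentError, sequentialError]
  constructor
  · linarith [h.1]
  · linarith [h.2]

/-- Increments are nonnegative and at most the current bound, and shrinkage of a nonnegative gap can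
be ignored from above. -/
lemma errorGap_mem (hdvd : ∀ t, 1 ≤ t → t < T → t ∣ M) (hM : 1 ≤ M)
    (hp : 100 * (T * ((n : ℝ) + M)) ≤ p) (i : ℕ) (t : ℕ) (ht : t < T) :
    0 ≤ concurrentError n M p σ i t - sequentialError n M p σ i t ∧
    concurrentError n M p σ i t - sequentialError n M p σ i t ≤
      t * (5 * (stagePairs n M t * (1 + σ ^ 2)) / p ^ 2) := by
  induction t with
  | zero => simp [concurrentError, sequentialError]
  | succ t ih =>
    obtain ⟨ih0, ih1⟩ := ih (by omega)
    obtain ⟨h1, h2⟩ := errorGap_bounds (σ := σ) hdvd hM hp i (t := t) (by omega)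
    have hM' : (1 : ℝ) ≤ M := by exact_mod_cast hM
    have hT1 : (1 : ℝ) ≤ T := by exact_mod_cast (by omega : 1 ≤ T)
    have hTN : (n : ℝ) + M ≤ T * (n + M) := le_mul_of_one_le_left (by positivity) hT1
    have hn0 : (0 : ℝ) ≤ n := Nat.cast_nonneg _
    have hp0 : 0 < p := by linarith
    have hsz : stageSize n M t ≤ n + M := stageSize_le hdvd (by omega : t < T)
    have hsz0 := stageSize_nonneg n M t
    have hc0 : 0 ≤ stageSize n M t / p := by positivity
    have hc1 : stageSize n M t / p ≤ 1 := by rw [div_le_one hp0]; linarith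
    have hJ0 := stagePairs_nonneg n M t
    have hg0 : 0 ≤ stagePairs n M t * (1 + σ ^ 2) / (4 * p ^ 2) := by positivity
    constructor
    · nlinarith
    · have hJ := stagePairs_mono (n := n) hdvd ht
      have hJ2 : 5 * (stagePairs n M t * (1 + σ ^ 2)) / p ^ 2 ≤
          5 * (stagePairs n M (t + 1) * (1 + σ ^ 2)) / p ^ 2 := by gcongr
      have ht0 : (0 : ℝ) ≤ t := Nat.cast_nonneg _
      have hJ3 := mul_le_mul_of_nonneg_left hJ2 ht0
      have h3 := mul_nonneg hc0 ih0
      push_cast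
      linarith

/-- With `q` the pair count times `(1 + σ ^ 2) / p ^ 2`, the stage gains at least `q / 4`. The old
gap is at most `5 * t * q`, of which shrinkage takes at most `q / 20`. The first stage is excluded
since it has no pairs. -/
lemma errorGap_lt_succ (hdvd : ∀ t, 1 ≤ t → t < T → t ∣ M) (hn : 1 ≤ n) (hM : 1 ≤ M)
    (hp : 100 * (T * ((n : ℝ) + M)) ≤ p) (i : ℕ) {t : ℕ} (ht1 : 1 ≤ t) (ht : t < T) :
    concurrentError n M p σ i t - sequentialError n M p σ i t <
      concurrentError n M p σ i (t + 1) - sequentialError n M p σ i (t + 1) := by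
  obtain ⟨h0, h1⟩ := errorGap_mem (σ := σ) hdvd hM hp i t ht
  obtain ⟨h2, -⟩ := errorGap_bounds (σ := σ) hdvd hM hp i ht
  have hM' : (1 : ℝ) ≤ M := by exact_mod_cast hM
  have hn' : (1 : ℝ) ≤ n := by exact_mod_cast hn
  have hT1 : (1 : ℝ) ≤ T := by exact_mod_cast (by omega : 1 ≤ T)
  have hTN : (n : ℝ) + M ≤ T * (n + M) := le_mul_of_one_le_left (by positivity) hT1
  have hp0 : 0 < p := by linarith
  have hsz : stageSize n M t = n + M := stageSize_eq n M t (hdvd t ht1 ht)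
  have hJ0 : 0 < stagePairs n M t := by
    rw [stagePairs_eq n M t ht1 (hdvd t ht1 ht)]
    have h3 : (1 : ℝ) / t ≤ 1 := by
      rw [div_le_one (by positivity)]
      exact_mod_cast ht1
    have h4 : (0 : ℝ) ≤ M ^ 2 * (1 - 1 / t) := mul_nonneg (by positivity) (by linarith)
    positivity
  have hq : 0 < stagePairs n M t * (1 + σ ^ 2) / p ^ 2 := by positivity
  have e1 : stagePairs n M t * (1 + σ ^ 2) / (4 * p ^ 2) =
      1 / 4 * (stagePairs n M t * (1 + σ ^ 2) / p ^ 2) := by field_simp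
  have e2 : t * (5 * (stagePairs n M t * (1 + σ ^ 2)) / p ^ 2) =
      5 * t * (stagePairs n M t * (1 + σ ^ 2) / p ^ 2) := by ring
  rw [e1] at h2
  rw [e2] at h1
  set q := stagePairs n M t * (1 + σ ^ 2) / p ^ 2
  have h5 : stageSize n M t / p * t ≤ 1 / 100 := by
    have h6 : (t : ℝ) ≤ T := by exact_mod_cast ht.le
    have h7 : stageSize n M t * t ≤ T * (n + M) := by
      rw [hsz, mul_comm (T : ℝ)]; gcongr
    rw [div_mul_eq_mul_div, div_le_iff₀ hp0]
    linarith
  have hc0 : 0 ≤ stageSize n M t / p := div_nonneg (stageSize_nonneg _ _ _) hp0.le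
  have h8 := mul_le_mul_of_nonneg_left h1 hc0
  have h9 : stageSize n M t / p * (5 * t * q) ≤ 1 / 20 * q := by nlinarith
  linarith

lemma errorGap_lt_last (hdvd : ∀ t, 1 ≤ t → t < T → t ∣ M) (hn : 1 ≤ n) (hM : 1 ≤ M)
    (hp : 100 * (T * ((n : ℝ) + M)) ≤ p) (i : ℕ) {t : ℕ} (ht1 : 1 ≤ t) (ht : t < T) :
    concurrentError n M p σ i t - sequentialError n M p σ i t <
      concurrentError n M p σ i T - sequentialError n M p σ i T := by
  have key : ∀ s, t + 1 ≤ s → s ≤ T →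
      concurrentError n M p σ i t - sequentialError n M p σ i t <
      concurrentError n M p σ i s - sequentialError n M p σ i s := by
    intro s hs
    induction s, hs using Nat.le_induction with
    | base => exact fun _ => errorGap_lt_succ hdvd hn hM hp i ht1 ht
    | succ s hs ih =>
      intro hsT
      exact (ih (by omega)).trans (errorGap_lt_succ hdvd hn hM hp i (by omega) (by omega))
  exact key T ht le_rfl

end Compare

end Rehearsal

theorem theorem3 :
    ∃ C : ℝ, 0 < C ∧
      ∀ (T n M p : ℕ), 2 ≤ T → 1 ≤ n → 2 ≤ M →
        -- the memory can be allocated equally to the previous tasks at every time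
        (∀ t : ℕ, 2 ≤ t → t ≤ T → (t - 1) ∣ M) →
        C * (T : ℝ) ^ 4 * (n : ℝ) ^ 2 * (M : ℝ) ^ 2 ≤ (p : ℝ) →
      ∀ (σ : NNReal) (wstar : Fin T → Rehearsal.Vec p), Orthonormal ℝ wstar →
      ∀ (Ω : Type*) [MeasurableSpace Ω] (P : MeasureTheory.Measure Ω)
        [MeasureTheory.IsProbabilityMeasure P]
        (X : Rehearsal.Sample T n M → Ω → Rehearsal.Vec p)
        (z : Rehearsal.Sample T n M → Ω → ℝ),
        Rehearsal.IsGaussianData P σ X z →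
        -- all the expectations that occur are finite
        (∀ (i : Fin T) (t : ℕ), t ≤ T →
          MeasureTheory.Integrable (fun ω => Rehearsal.modelError wstar i
            (Rehearsal.concurrentParam wstar X z t ω)) P ∧
          MeasureTheory.Integrable (fun ω => Rehearsal.modelError wstar i
            (Rehearsal.sequentialParam wstar X z t ω)) P) ∧
        Rehearsal.forgetting P wstar (Rehearsal.concurrentParam wstar X z) >
          Rehearsal.forgetting P wstar (Rehearsal.sequentialParam wstar X z) ∧
        Rehearsal.generalizationError P wstar (Rehearsal.concurrentParam wstar X z) >
          Rehearsal.generalizationError P wstar (Rehearsal.sequentialParam wstar X z) := by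
  refine ⟨100, by norm_num, ?_⟩
  intro T n M p hT hn hM hdiv hp σ wstar ho Ω _ P _ X z hD
  -- Shift from tasks numbered from one to stages numbered from zero.
  have hdvd : ∀ t, 1 ≤ t → t < T → t ∣ M := fun t h1 h2 => by
    simpa using hdiv (t + 1) (by omega) (by omega)
  have hT' : (2 : ℝ) ≤ T := by exact_mod_cast hT
  have hn' : (1 : ℝ) ≤ n := by exact_mod_cast hn
  have hM' : (2 : ℝ) ≤ M := by exact_mod_cast hM
  -- The comparison needs only this linear bound, with `C = 100`. Here `M ≥ 2` enters: `n + M ≤ n ^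
  -- 2 * M ^ 2` fails for `n = M = 1`.
  have hp' : 100 * (T * ((n : ℝ) + M)) ≤ p := by
    refine le_trans ?_ hp
    have h1 : (n : ℝ) + M ≤ n ^ 2 * M ^ 2 := by
      have h3 : (2 : ℝ) ≤ n * M := by nlinarith
      have h4 : 0 ≤ ((n : ℝ) - 1) * (M - 1) := mul_nonneg (by linarith) (by linarith)
      rw [← mul_pow]
      nlinarith
    have h2 : (T : ℝ) ≤ T ^ 4 := le_self_pow₀ (by linarith) (by norm_num)
    calc 100 * (T * ((n : ℝ) + M)) ≤ 100 * (T ^ 4 * (n ^ 2 * M ^ 2)) := by gcongr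
      _ = _ := by ring
  have hTN : 2 * ((n : ℝ) + M) ≤ T * (n + M) := by gcongr
  have hcard : ∀ t < T, (∑ k ∈ Finset.range (t + 1), Rehearsal.blockSize n M t k) + 2 ≤ p := by
    intro t ht
    have h := Rehearsal.stageSize_le (n := n) hdvd ht
    have h2 : Rehearsal.stageSize n M t + 2 ≤ p := by linarith
    rw [Rehearsal.stageSize] at h2
    exact_mod_cast h2
  have hE := fun i t ht => hD.integral_modelError ho hcard i t ht
  have hgap := fun (i : ℕ) (t : ℕ) (h1 : 1 ≤ t) (h2 : t < T) =>
    Rehearsal.errorGap_lt_last (n := n) (σ := (σ : ℝ)) hdvd hn (by omega) hp' i h1 h2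
  refine ⟨fun i t ht => ⟨(hE i t ht).1.1, (hE i t ht).2.1⟩, ?_, ?_⟩
  · have hT1 : (0 : ℝ) < 1 / ((T : ℝ) - 1) := one_div_pos.2 (by linarith)
    refine mul_lt_mul_of_pos_left (Finset.sum_lt_sum_of_nonempty
      ⟨⟨0, by omega⟩, by simp; omega⟩ fun i hi => ?_) hT1
    have hi' : (i : ℕ) + 1 < T := (Finset.mem_filter.1 hi).2
    rw [integral_sub (hE i T le_rfl).1.1 (hE i _ hi'.le).1.1,
      integral_sub (hE i T le_rfl).2.1 (hE i _ hi'.le).2.1, (hE i T le_rfl).1.2,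
      (hE i _ hi'.le).1.2, (hE i T le_rfl).2.2, (hE i _ hi'.le).2.2]
    linarith [hgap i (i + 1) (by omega) hi']
  · have hT0 : (0 : ℝ) < 1 / (T : ℝ) := one_div_pos.2 (by linarith)
    refine mul_lt_mul_of_pos_left (Finset.sum_lt_sum_of_nonempty
      ⟨⟨0, by omega⟩, Finset.mem_univ _⟩ fun i _ => ?_) hT0
    rw [(hE i T le_rfl).1.2, (hE i T le_rfl).2.2]
    -- The gap after one task is nonnegative, and strict growth from there to `T` makes the final
    -- gap positive.
    have h0 := (Rehearsal.errorGap_mem (n := n) (σ := (σ : ℝ)) hdvd (by omega) hp' i 1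
      (by omega)).1
    linarith [hgap i 1 le_rfl (by omega)]
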